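/- **Model.** There are $n$ robots in the Euclidean plane; a robot is an opaque closed disk of diameter $1$, and its position is its centre. Robot $i$ sees robot $j$ if some point of the bounding circle of $j$ is joined to some point of the bounding circle of $i$ by a segment that meets no third robot. Each robot has its own fixed Cartesian coordinate system (arbitrary origin, orientation and handedness, common unit length). All robots run the same algorithm and are fully synchronous: in each round every robot takes a snapshot of the set of positions of the robots it sees, in its own coordinate system, computes a new memory content and a destination from the snapshot, its own position and its memory, and moves straight to the destination. One unit of memory holds a location, one of the integers $0,\dots,n$, or a control variable with a fixed finite range. A target pattern is a nonempty finite set $P$ of $k\le n$ points at mutual distances at least $1$, known to all robots. **Start.** No two robots touch (all distances of distinct robots are $>1$), all robots see each other, and there is a point $c$ such that every robot other than the leader is strictly closer to $c$ than the leader is (so the leader is a corner of the convex hull). The leader knows that it is the leader and has stored $c$; the others only know that they are not the leader. **The Pattern Formation phase.** *A non-leader*, if it is idle and touched (another robot at distance exactly $1$), stores the direction of the touching robot; in the next round it stores the location of the closest robot that it sees exactly in that direction (becoming idle again if there is none); in each following round it checks whether it sees a robot at distance less than $1$ from that location, and if not it moves there and becomes idle. *The leader* turns its coordinate system by a multiple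 of $90^\circ$ so that the vector from $c$ to the leader has negative first and nonnegative second coordinate; all coordinates below are in this system. Let $x_{\min}$ and $y_{\max}$ be the smallest abscissa and the largest ordinate of the robots at the start, let $r_1,\dots,r_{n-1}$ be the other robots, ordered from left to right with ties broken from top to bottom, and let $p_1,\dots,p_k$ be the points of $5P+v$ in the same order, where the translation $v$ is such that the largest abscissa is $x_{\min}-100$ and the smallest ordinate is $y_{\max}+100$. The leader first moves away from $c$ along the line through $c$ and itself to abscissa $x_{\min}-2$, and then to the point $r_1-(1,0)$ (for $n=1$ it goes directly to the last step below; if then $c$ is its own position, it skips the first move and turns its coordinate system by $270^\circ$). For $i=1,\dots,\min(k,n-1)$, starting at $r_i-(1,0)$, it goes in successive rounds to $q=(x_{\min}-90,y(r_i))$ and $q+(0,1)$, waits one round, goes to $q'=(x_{\min}-90,y(p_i))$ and $q'-(1,0)$, waits one round, goes to $p_i$ and $p_i-(0,2)$, and waits one round. If $i<\min(k,n-1)$, it then moves horizontally to abscissa $x(r_{i+1})-1$ and vertically to $r_{i+1}-(1,0)$, where $r_{i+1}$ is the first, in the above order, of the robots it sees with abscissa at least $x_{\min}$. Otherwise it moves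 horizontally to abscissa $x_{\min}-90$. Last step: if $k=n$, it goes to $(x_{\min}-90,y(p_n))$ and then to $p_n$. The phase ends when the leader has finished this and all other robots are idle. **Theorem.** There are absolute constants $C$ and $M$ such that, for all $n$, all target patterns with $k\le n$ points, all coordinate systems and all starts as above, the execution of the phase has the following properties. 1. After at most $Cn$ rounds the phase has ended, and positions and memories no longer change. In the coordinate system of the leader, turned by a multiple of $90^\circ$, and for some translation vector $v$: the closed top left quadrant at the leader's start position contained no other robot; every point of $5P+v$ is at least $100$ to the left of and at least $100$ above all start positions (so it lies outside their convex hull); every point of $5P+v$ is occupied by a robot; for $i\le\min(k,n-1)$ the robot $r_i$ is at the $i$-th point of $5P+v$; if $k=n$ the leader is at the $n$-th one; and the robots $r_i$ with $k<i\le n-1$ are at their start positions. 2. There are no collisions: in each round, any point of the path of a robot and any point of the path of another robot are at distance at least $1$. 3. Every robot uses at most $M$ units of memory at all times. 4. At most one robot moves in each round. 5. If a robot $r$ other than the leader moves in round $t$ (rounds are numbered from $0$), then $t\ge 2$, and $r$ did not change its position between the beginning of round $t-2$ and the beginning of round $t$; at the beginning of round $t-2$ the leader touched $r$ (distance exactly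 $1$) in the direction of the move, and at the beginning of round $t-1$ the leader was at the destination of the move. -/

import Mathlib

noncomputable section

open Complex

namespace FatRobots

/-! ### Fat robots in the plane

The Euclidean plane is `ℂ` (`re` and `im` are the two coordinates, `dist` is the Euclidean distance).
A robot is a closed disk of diameter 1; its position is its centre. -/

/-- Robot `i` sees robot `j`: some point `b` of the bounding circle of `j` is joined to some point
`a` of the bounding circle of `i` by a segment that meets no third robot. -/
def Sees {n : ℕ} (pos : Fin n → ℂ) (i j : Fin n) : Prop :=
  ∃ a ∈ Metric.sphere (pos i) (1 / 2), ∃ b ∈ Metric.sphere (pos j) (1 / 2),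
    ∀ k : Fin n, k ≠ i → k ≠ j →
      Disjoint (segment ℝ a b) (Metric.closedBall (pos k) (1 / 2))

/-! ### The left-to-right order, ties being broken from top to bottom -/

/-- `z` comes before (or is) `w`. -/
def LeftTop (z w : ℂ) : Prop := z.re < w.re ∨ (z.re = w.re ∧ w.im ≤ z.im)

instance : DecidableRel LeftTop := fun _ _ => Classical.propDecidable _

instance : IsTrans ℂ LeftTop where
  trans a b c := by
    rintro (h | ⟨h, h'⟩) (k | ⟨k, k'⟩)
    · exact Or.inl (h.trans k)
    · exact Or.inl (k ▸ h)
    · exact Or.inl (h ▸ k)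
    · exact Or.inr ⟨h.trans k, k'.trans h'⟩

instance : Std.Antisymm LeftTop where
  antisymm a b := by
    rintro (h | ⟨h, h'⟩) (k | ⟨k, k'⟩)
    · exact absurd h k.asymm
    · exact absurd h (by simp [k])
    · exact absurd k (by simp [h])
    · exact Complex.ext h (le_antisymm k' h')

instance : Std.Total LeftTop where
  total a b := by
    rcases lt_trichotomy a.re b.re with h | h | h
    · exact Or.inl (Or.inl h)
    · rcases le_total a.im b.im with k | k
      · exact Or.inr (Or.inr ⟨h.symm, k⟩)
      · exact Or.inl (Or.inr ⟨h, k⟩)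
    · exact Or.inr (Or.inl h)

/-- The points of a finite set, listed from left to right, ties from top to bottom. -/
def ordered (S : Finset ℂ) : List ℂ := S.sort LeftTop

/-! ### Target patterns -/

/-- A target pattern: a nonempty finite set of positions for unit-diameter disks. -/
structure Pattern where
  points : Finset ℂ
  nonempty : points.Nonempty
  separated : ∀ p ∈ points, ∀ q ∈ points, p ≠ q → 1 ≤ dist p q

/-- The translation applied after scaling by 5. With `corner = (x_min, y_max)`, the rightmost
abscissa of the scaled pattern becomes `x_min - 100` and its lowest ordinate `y_max + 100`. -/
def Pattern.shift (P : Pattern) (corner : ℂ) : ℂ :=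
  ⟨corner.re - 100 - 5 * P.points.sup' P.nonempty Complex.re,
   corner.im + 100 - 5 * P.points.inf' P.nonempty Complex.im⟩

/-- The `i`-th position (counted from 0) of the scaled and translated pattern. -/
def Pattern.slot (P : Pattern) (corner : ℂ) (i : ℕ) : ℂ :=
  5 * (ordered P.points).getD i 0 + P.shift corner

/-! ### The memory of a robot -/

/-- The control states of the leader. -/
inductive Stage
  | depart | beside
  | leadLeft | signalUp | waitLeft
  | leadUp | signalLeft | waitUp
  | leadSlot | stepAway | waitSlot
  | next | fillUp | fillSlot | done

/-- What the leader stores. `count` is the number of robots, `index` the number of robots already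
placed, `centre` the centre of the circle of the leader election, `corner` the point
`(x_min, y_max)`, `aim` the location of the robot that is to be fetched, and `turn` the number of
quarter turns by which the leader turns its coordinate system. -/
structure LeaderMemory where
  stage : Stage
  turn : Fin 4
  count : ℕ
  index : ℕ
  centre : ℂ
  corner : ℂ
  aim : ℂ

/-- What the other robots store: nothing, the direction they have been shown, or the location to
which they have been told to move. -/
inductive FollowerMemory
  | idle
  | directed (e : ℂ)
  | instructed (dest : ℂ)

inductive Memory
  | leader (m : LeaderMemory)
  | follower (m : FollowerMemory)

/-- The number of memory units needed for the integer `m` when there are `n` robots: one unit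
holds one of the integers `0, …, n`. -/
def intUnits (n m : ℕ) : ℕ := (Nat.digits (n + 1) m).length

/-- The number of memory units in use when there are `n` robots: one for each stored location and
for each control variable with a fixed finite range, and `intUnits n m` for each integer `m`. -/
def Memory.units (n : ℕ) : Memory → ℕ
  | .leader m => 2 + intUnits n m.count + intUnits n m.index + 3
  | .follower .idle => 1
  | .follower (.directed _) => 2
  | .follower (.instructed _) => 2

/-! ### The algorithm of the Pattern Formation phase

A robot computes, from its memory, its own position and the set of the positions of the robots it
sees (all in its own coordinate system), its new memory and its destination. -/

open Classical in
/-- A robot that is not the leader. If it is touched, it stores the direction of the robot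
touching it; one round later it looks how far away the closest robot in that direction is and
stores that location; once that location is free it moves there. -/
def followerStep (m : FollowerMemory) (self : ℂ) (seen : Finset ℂ) : FollowerMemory × ℂ :=
  match m with
  | .idle =>
    match (ordered (seen.filter fun q => dist q self = 1)).head? with
    | none => (.idle, self)
    | some q => (.directed (q - self), self)
  | .directed e =>
    let ahead := (seen.filter fun q => ∃ s : ℝ, 0 < s ∧ q = self + s * e).image (dist self)
    if h : ahead.Nonempty then (.instructed (self + (ahead.min' h : ℝ) * e), self)
    else (.idle, self)
  | .instructed dest =>
    if ∃ q ∈ seen, dist q dest < 1 then (.instructed dest, self) else (.idle, dest)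

open Classical in
/-- The number of quarter turns that bring a nonzero vector to the half-open second quadrant. -/
def quarterTurns (u : ℂ) : Fin 4 :=
  if u.re < 0 ∧ 0 ≤ u.im then 0
  else if (I * u).re < 0 ∧ 0 ≤ (I * u).im then 1
  else if (I ^ 2 * u).re < 0 ∧ 0 ≤ (I ^ 2 * u).im then 2
  else 3

open Classical in
/-- The leader, in its turned coordinate system; `centre` is the centre of the circle there. -/
def leaderMove (P : Pattern) (m : LeaderMemory) (centre self : ℂ) (seen : Finset ℂ) :
    LeaderMemory × ℂ :=
  let k := P.points.card
  let corridor : ℝ := m.corner.re - 90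
  match m.stage with
  -- leave the circle perpendicularly, up to the abscissa `x_min - 2`
  | .depart =>
    let all := insert self seen
    let xmin : ℝ := all.inf' (Finset.insert_nonempty _ _) Complex.re
    let ymax : ℝ := all.sup' (Finset.insert_nonempty _ _) Complex.im
    let u := self - centre
    ({ m with
        stage := if seen = ∅ then .fillUp else .beside
        count := all.card
        index := 0
        corner := ⟨xmin, ymax⟩
        aim := (ordered seen).headD 0 },
      self + (((self.re - xmin + 2) / (-u.re) : ℝ) : ℂ) * u)
  -- go to the place directly to the left of the robot to be fetched
  | .beside => ({ m with stage := .leadLeft }, m.aim - 1)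
  -- first leg: horizontally to the abscissa `x_min - 90`
  | .leadLeft => ({ m with stage := .signalUp }, ⟨corridor, self.im⟩)
  | .signalUp => ({ m with stage := .waitLeft }, self + I)
  | .waitLeft => ({ m with stage := .leadUp }, self)
  -- second leg: vertically up to the ordinate of the pattern position
  | .leadUp => ({ m with stage := .signalLeft }, ⟨corridor, (P.slot m.corner m.index).im⟩)
  | .signalLeft => ({ m with stage := .waitUp }, self - 1)
  | .waitUp => ({ m with stage := .leadSlot }, self)
  -- third leg: horizontally to the pattern position; then two positions down, out of touch
  | .leadSlot => ({ m with stage := .stepAway }, P.slot m.corner m.index)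
  | .stepAway => ({ m with stage := .waitSlot }, self - 2 * I)
  | .waitSlot => ({ m with stage := .next, index := m.index + 1 }, self)
  -- fetch the next robot, or end the phase, or take the last position
  | .next =>
    if m.index < k ∧ m.index + 1 < m.count then
      let aim := (ordered (seen.filter fun q => m.corner.re ≤ q.re)).headD 0
      ({ m with stage := .beside, aim := aim }, ⟨aim.re - 1, self.im⟩)
    else ({ m with stage := if k = m.count then .fillUp else .done }, ⟨corridor, self.im⟩)
  | .fillUp => ({ m with stage := .fillSlot }, ⟨corridor, (P.slot m.corner (k - 1)).im⟩)
  | .fillSlot => ({ m with stage := .done }, P.slot m.corner (k - 1))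
  | .done => (m, self)

/-- When it departs, the leader turns its coordinate system so that the empty quadrant is the
top left one. -/
def LeaderMemory.orient (m : LeaderMemory) (self : ℂ) : LeaderMemory :=
  match m.stage with
  | .depart => { m with turn := quarterTurns (self - m.centre) }
  | _ => m

/-- The leader, in its own coordinate system. -/
def leaderStep (P : Pattern) (m : LeaderMemory) (self : ℂ) (seen : Finset ℂ) :
    LeaderMemory × ℂ :=
  let o := m.orient self
  let w : ℂ := I ^ (o.turn : ℕ)
  let r := leaderMove P o (w * o.centre) (w * self) (seen.image fun q => w * q)
  (r.1, (-I) ^ (o.turn : ℕ) * r.2)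

/-- The common algorithm of all robots. -/
def robotStep (P : Pattern) (m : Memory) (self : ℂ) (seen : Finset ℂ) : Memory × ℂ :=
  match m with
  | .leader m => let r := leaderStep P m self seen; (.leader r.1, r.2)
  | .follower m => let r := followerStep m self seen; (.follower r.1, r.2)

/-! ### Fully synchronous executions -/

structure Config (n : ℕ) where
  pos : Fin n → ℂ
  mem : Fin n → Memory

open Classical in
/-- The snapshot of robot `i`, in its own coordinate system `frame`. -/
def snapshot {n : ℕ} (frame : ℂ ≃ᵃⁱ[ℝ] ℂ) (pos : Fin n → ℂ) (i : Fin n) : Finset ℂ :=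
  (Finset.univ.filter fun j => j ≠ i ∧ Sees pos i j).image fun j => frame (pos j)

/-- What robot `i` computes in one round, in its own coordinate system. -/
def compute {n : ℕ} (P : Pattern) (frame : Fin n → ℂ ≃ᵃⁱ[ℝ] ℂ) (E : Config n) (i : Fin n) :
    Memory × ℂ :=
  robotStep P (E.mem i) (frame i (E.pos i)) (snapshot (frame i) E.pos i)

/-- One round: all robots look, compute and move simultaneously. -/
def round {n : ℕ} (P : Pattern) (frame : Fin n → ℂ ≃ᵃⁱ[ℝ] ℂ) (E : Config n) : Config n where
  pos i := (frame i).symm (compute P frame E i).2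
  mem i := (compute P frame E i).1

open Classical in
/-- The beginning of the phase: the leader `l` knows that it is the leader and knows the centre
`c` of the circle of the leader election; the other robots only know that they are not leaders. -/
def initial {n : ℕ} (frame : Fin n → ℂ ≃ᵃⁱ[ℝ] ℂ) (pos : Fin n → ℂ) (l : Fin n) (c : ℂ) :
    Config n where
  pos := pos
  mem i :=
    if i = l then
      .leader
        { stage := .depart, turn := 0, count := 0, index := 0, centre := frame l c,
          corner := 0, aim := 0 }
    else .follower .idle

/-- The configuration after `t` rounds. -/
def execution {n : ℕ} (P : Pattern) (frame : Fin n → ℂ ≃ᵃⁱ[ℝ] ℂ) (pos : Fin n → ℂ) (l : Fin n)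
    (c : ℂ) (t : ℕ) : Config n :=
  (round P frame)^[t] (initial frame pos l c)

/-! ### The situation before the phase, and what the phase achieves -/

/-- The situation after a leader election: no two robots touch, all robots see each other, and
the leader `l` is the only robot on a circle around `c` that has all other robots inside it. -/
structure LeaderElected {n : ℕ} (pos : Fin n → ℂ) (l : Fin n) (c : ℂ) : Prop where
  apart : ∀ i j, i ≠ j → 1 < dist (pos i) (pos j)
  visible : ∀ i j, i ≠ j → Sees pos i j
  circle : ∀ j, j ≠ l → dist (pos j) c < dist (pos l) c

/-- No two robots collide while moving on straight lines from the positions `pos` to the positions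
`pos'`, whatever their speeds: no point of the path of one robot is at distance less than 1
from a point of the path of another one. -/
def CollisionFree {n : ℕ} (pos pos' : Fin n → ℂ) : Prop :=
  ∀ i j, i ≠ j → ∀ x ∈ segment ℝ (pos i) (pos' i), ∀ y ∈ segment ℝ (pos j) (pos' j),
    1 ≤ dist x y

/-- The phase has ended. -/
def Memory.IsDone : Memory → Prop
  | .leader m => m.stage = .done
  | .follower m => m = .idle

/-- The outcome of the phase. In the coordinate system `g`, the quadrant to the top left of the
leader `l` was empty at the start; the pattern, scaled by 5 and translated by `v`, lies above and to
the left of the convex hull of the start positions; and it is formed by the robots: the `i`-th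
robot in the order from left to right is at the `i`-th position of the pattern, the leader takes the
last position if the pattern has one position for each robot, and robots that are not needed
are where they were. -/
structure Outcome {n : ℕ} (P : Pattern) (g : ℂ → ℂ) (v : ℂ) (start final : Fin n → ℂ)
    (l : Fin n) : Prop where
  emptyQuadrant : ∀ j, j ≠ l →
    ¬ ((g (start j)).re ≤ (g (start l)).re ∧ (g (start l)).im ≤ (g (start j)).im)
  outside : ∀ p ∈ P.points, ∀ j,
    (5 * p + v).re ≤ (g (start j)).re - 100 ∧ (g (start j)).im + 100 ≤ (5 * p + v).im
  formed : ∀ p ∈ P.points, ∃ j, g (final j) = 5 * p + v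
  placed : ∀ j, j ≠ l → ∀ i,
    (ordered ((Finset.univ.erase l).image fun j => g (start j)))[i]? = some (g (start j)) →
      (∀ p, (ordered P.points)[i]? = some p → g (final j) = 5 * p + v) ∧
      (P.points.card ≤ i → final j = start j)
  leaderPlaced : P.points.card = n →
    ∀ p, (ordered P.points)[n - 1]? = some p → g (final l) = 5 * p + v

end FatRobots

end

noncomputable section

open Complex

namespace FatRobots

/-! ### Distances and segments in the plane -/

/-! Robots compute only in their own frames, so the execution may be read in any global frame
(`execution_map`). In the turned frame of the leader, where the vector from `c` to the leader lies
in the second quadrant, it becomes a `Scene`. There every configuration has the form `config i f L a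
m μ`: the leader is at `L`, at most one active follower `f` is at `a`, and every other follower is
idle, at its slot if its rank is below `i` and at its start otherwise. As long as the leader and `f`
stay at distance more than 1 from these others (`Clear`), none of the others is touched and all
remain idle. A round is then determined by what the leader and `f` do (`round_config`).

A follower is moved by three instances of one manoeuvre, `leg`: the leader touches `f`, goes to the
destination, and steps aside. After the first two legs the place beside the destination is exactly
where the next leg must start; after the third it is out of touch. `fetch` combines one approach
with three legs, and `exists_fetch` iterates it.

The paths are clear because of the order. Followers are taken from left to right, so no waiting
robot lies to the left of the one being moved, and slots are filled from left to right but entered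
from the right. Between the starts and the pattern runs an empty corridor, and the factor 5 leaves
room for the leader to step down beside a filled slot (`slots_clear_of_slot`). The leader departs
along a ray from the centre of a disk that contains all others, hence comes closer to none of them
(`clear_departure`). -/

theorem dist_sq_eq (z w : ℂ) : dist z w ^ 2 = (z.re - w.re) ^ 2 + (z.im - w.im) ^ 2 := by
  rw [Complex.dist_eq_re_im, Real.sq_sqrt (by positivity)]

theorem lt_dist_of_sq {z w : ℂ} {d : ℝ} (h : d ^ 2 < (z.re - w.re) ^ 2 + (z.im - w.im) ^ 2) :
    d < dist z w := by
  rw [← dist_sq_eq] at h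
  exact lt_of_pow_lt_pow_left₀ 2 dist_nonneg h

theorem sq_lt_of_lt_dist {z w : ℂ} {d : ℝ} (hd : 0 ≤ d) (h : d < dist z w) :
    d ^ 2 < (z.re - w.re) ^ 2 + (z.im - w.im) ^ 2 := by
  rw [← dist_sq_eq]
  gcongr

theorem sq_le_of_le_dist {z w : ℂ} {d : ℝ} (hd : 0 ≤ d) (h : d ≤ dist z w) :
    d ^ 2 ≤ (z.re - w.re) ^ 2 + (z.im - w.im) ^ 2 := by
  rw [← dist_sq_eq]
  gcongr

theorem re_sub_le_dist (z w : ℂ) : z.re - w.re ≤ dist z w := by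
  rw [dist_eq_norm, ← sub_re]
  exact re_le_norm _

theorem im_sub_le_dist (z w : ℂ) : z.im - w.im ≤ dist z w := by
  rw [dist_eq_norm, ← sub_im]
  exact (le_abs_self _).trans (abs_im_le_norm _)

theorem re_le_of_mem_segment {x y z : ℂ} {c : ℝ} (hx : x.re ≤ c) (hy : y.re ≤ c)
    (hz : z ∈ segment ℝ x y) : z.re ≤ c :=
  (convex_halfSpace_re_le c).segment_subset hx hy hz

theorem le_re_of_mem_segment {x y z : ℂ} {c : ℝ} (hx : c ≤ x.re) (hy : c ≤ y.re)
    (hz : z ∈ segment ℝ x y) : c ≤ z.re :=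
  (convex_halfSpace_re_ge c).segment_subset hx hy hz

theorem im_le_of_mem_segment {x y z : ℂ} {c : ℝ} (hx : x.im ≤ c) (hy : y.im ≤ c)
    (hz : z ∈ segment ℝ x y) : z.im ≤ c :=
  (convex_halfSpace_im_le c).segment_subset hx hy hz

theorem le_im_of_mem_segment {x y z : ℂ} {c : ℝ} (hx : c ≤ x.im) (hy : c ≤ y.im)
    (hz : z ∈ segment ℝ x y) : c ≤ z.im :=
  (convex_halfSpace_im_ge c).segment_subset hx hy hz

/-! ### The left-to-right order -/

theorem re_le_of_leftTop {z w : ℂ} (h : LeftTop z w) : z.re ≤ w.re :=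
  h.elim le_of_lt fun h => h.1.le

theorem leftTop_refl (z : ℂ) : LeftTop z z := Or.inr ⟨rfl, le_rfl⟩

theorem ordered_getElem_leftTop (S : Finset ℂ) {i j : ℕ} (hij : i ≤ j)
    (hj : j < (ordered S).length) : LeftTop (ordered S)[i] (ordered S)[j] := by
  rcases hij.eq_or_lt with rfl | h
  · exact leftTop_refl _
  · exact List.pairwise_iff_getElem.1 (Finset.pairwise_sort S LeftTop) i j _ hj h

theorem ordered_headD_eq {S : Finset ℂ} {y : ℂ} (hy : y ∈ S) (h : ∀ z ∈ S, LeftTop y z) (d : ℂ) :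
    (ordered S).headD d = y := by
  have hne : 0 < (ordered S).length := by
    rw [ordered, Finset.length_sort]
    exact Finset.card_pos.2 ⟨y, hy⟩
  have hh : (ordered S).headD d = (ordered S)[0] := by
    rw [List.headD_eq_head?_getD, List.head?_eq_getElem?, List.getElem?_eq_getElem hne]
    rfl
  rw [hh]
  obtain ⟨j, hj, hjy⟩ : ∃ j, ∃ hj : j < (ordered S).length, (ordered S)[j] = y := List.getElem_of_mem ((Finset.mem_sort (r := LeftTop)).2 hy)
  refine antisymm (r := LeftTop) ?_ (h _ ((Finset.mem_sort (r := LeftTop)).1 (List.getElem_mem hne)))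
  have := ordered_getElem_leftTop S (Nat.zero_le j) hj
  rwa [hjy] at this

theorem ordered_head?_eq_none {S : Finset ℂ} (h : S = ∅) : (ordered S).head? = none := by
  simp [h, ordered]

theorem ordered_head?_singleton (y : ℂ) : (ordered {y}).head? = some y := by
  simp [ordered]

/-! ### Visibility -/

/-- The two points of the segment of centres that lie on the bounding circles serve as ends of the
line of sight. Distance more than 1 from the other centres is more than visibility needs, but it is
what `Clear` supplies. -/
theorem sees_of_segment {n : ℕ} {pos : Fin n → ℂ} {i j : Fin n}
    (hij : 1 ≤ dist (pos i) (pos j))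
    (h : ∀ z ∈ segment ℝ (pos i) (pos j), ∀ k, k ≠ i → k ≠ j → 1 < dist z (pos k)) :
    Sees pos i j := by
  set d := dist (pos i) (pos j) with hd
  have hd0 : 0 < d := by linarith
  have ht : 1 / 2 / d ∈ Set.Icc (0 : ℝ) 1 :=
    ⟨by positivity, (div_le_one hd0).2 (by linarith)⟩
  have ht' : 1 - 1 / 2 / d ∈ Set.Icc (0 : ℝ) 1 := ⟨by linarith [ht.2], by linarith [ht.1]⟩
  have ha : AffineMap.lineMap (pos i) (pos j) (1 / 2 / d) ∈ segment ℝ (pos i) (pos j) := by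
    rw [segment_eq_image_lineMap]
    exact ⟨_, ht, rfl⟩
  have hb : AffineMap.lineMap (pos i) (pos j) (1 - 1 / 2 / d) ∈ segment ℝ (pos i) (pos j) := by
    rw [segment_eq_image_lineMap]
    exact ⟨_, ht', rfl⟩
  refine ⟨AffineMap.lineMap (pos i) (pos j) (1 / 2 / d), ?_,
    AffineMap.lineMap (pos i) (pos j) (1 - 1 / 2 / d), ?_,
    fun k hki hkj => Set.disjoint_left.2 fun z hz hzk => ?_⟩
  · rw [Metric.mem_sphere, dist_lineMap_left, ← hd, Real.norm_of_nonneg ht.1]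
    field_simp
  · rw [Metric.mem_sphere, dist_lineMap_right, ← hd, sub_sub_cancel, Real.norm_of_nonneg ht.1]
    field_simp
  · have h1 := h z ((convex_segment _ _).segment_subset ha hb hz) k hki hkj
    have h2 := Metric.mem_closedBall.1 hzk
    linarith

theorem Sees.image {n : ℕ} {pos : Fin n → ℂ} {i j : Fin n} (A : ℂ ≃ᵃⁱ[ℝ] ℂ) (h : Sees pos i j) :
    Sees (fun k => A (pos k)) i j := by
  obtain ⟨a, ha, b, hb, h⟩ := h
  refine ⟨A a, (A.dist_map _ _).trans ha, A b, (A.dist_map _ _).trans hb, fun k hki hkj => ?_⟩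
  have h1 : segment ℝ (A a) (A b) = A '' segment ℝ a b :=
    (image_segment ℝ A.toAffineEquiv.toAffineMap a b).symm
  have h2 := A.toIsometryEquiv.image_closedBall (pos k) (1 / 2)
  simp only [AffineIsometryEquiv.coe_toIsometryEquiv] at h2
  rw [h1, ← h2]
  exact (Set.disjoint_image_iff A.injective).2 (h k hki hkj)

theorem sees_image_iff {n : ℕ} {pos : Fin n → ℂ} {i j : Fin n} (A : ℂ ≃ᵃⁱ[ℝ] ℂ) :
    Sees (fun k => A (pos k)) i j ↔ Sees pos i j :=
  ⟨fun h => by simpa using h.image A.symm, fun h => h.image A⟩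

open Classical in
/-- The positions of the robots seen by robot `i`, in the global coordinate system. -/
def visible {n : ℕ} (pos : Fin n → ℂ) (i : Fin n) : Finset ℂ :=
  (Finset.univ.filter fun j => j ≠ i ∧ Sees pos i j).image pos

theorem mem_visible {n : ℕ} {pos : Fin n → ℂ} {i : Fin n} {z : ℂ} :
    z ∈ visible pos i ↔ ∃ j, (j ≠ i ∧ Sees pos i j) ∧ pos j = z := by
  simp [visible]

theorem mem_snapshot {n : ℕ} {h : ℂ ≃ᵃⁱ[ℝ] ℂ} {pos : Fin n → ℂ} {i : Fin n} {z : ℂ} :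
    z ∈ snapshot h pos i ↔ ∃ j, (j ≠ i ∧ Sees pos i j) ∧ h (pos j) = z := by
  simp [snapshot]

/-! ### Changing the global coordinate system -/

/-- The configuration `E` after applying the isometry `A` to all positions. -/
def Config.map {n : ℕ} (A : ℂ ≃ᵃⁱ[ℝ] ℂ) (E : Config n) : Config n where
  pos i := A (E.pos i)
  mem := E.mem

theorem snapshot_map {n : ℕ} (A h : ℂ ≃ᵃⁱ[ℝ] ℂ) (pos : Fin n → ℂ) (i : Fin n) :
    snapshot (A.symm.trans h) (fun j => A (pos j)) i = snapshot h pos i := by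
  ext z
  simp [mem_snapshot, sees_image_iff]

theorem round_map {n : ℕ} (P : Pattern) (A : ℂ ≃ᵃⁱ[ℝ] ℂ) (frame : Fin n → ℂ ≃ᵃⁱ[ℝ] ℂ)
    (E : Config n) :
    round P (fun i => A.symm.trans (frame i)) (E.map A) = (round P frame E).map A := by
  have h (i) : compute P (fun i => A.symm.trans (frame i)) (E.map A) i = compute P frame E i := by
    simp only [compute, Config.map, snapshot_map]
    simp
  simp only [round, h]
  rfl

/-- Moving the plane by `A` and precomposing each frame with the inverse of `A` leaves all snapshots
unchanged. This permits the leader's turned frame to serve as the global one. -/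
theorem execution_map {n : ℕ} (P : Pattern) (A : ℂ ≃ᵃⁱ[ℝ] ℂ) (frame : Fin n → ℂ ≃ᵃⁱ[ℝ] ℂ)
    (pos : Fin n → ℂ) (l : Fin n) (c : ℂ) (t : ℕ) :
    execution P (fun i => A.symm.trans (frame i)) (fun i => A (pos i)) l (A c) t =
      (execution P frame pos l c t).map A := by
  induction t with
  | zero => simp [execution, initial, Config.map]
  | succ t ih =>
    simp only [execution, Function.iterate_succ_apply'] at ih ⊢
    rw [ih, round_map]

/-! ### One step of a follower -/

section Follower

variable {n : ℕ} (h : ℂ ≃ᵃⁱ[ℝ] ℂ) {x : Fin n → ℂ} {j k : Fin n}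

theorem followerStep_untouched (hx : ∀ k, k ≠ j → dist (x k) (x j) ≠ 1) :
    followerStep .idle (h (x j)) (snapshot h x j) = (.idle, h (x j)) := by
  have : (snapshot h x j).filter (fun q => dist q (h (x j)) = 1) = ∅ := by
    refine Finset.filter_eq_empty_iff.2 fun q hq => ?_
    obtain ⟨k, ⟨hk, -⟩, rfl⟩ := mem_snapshot.1 hq
    simpa using hx k hk
  simp only [followerStep]
  rw [ordered_head?_eq_none (by convert this)]

/-- `LeftTop` is not invariant under isometries, so a choice among several touching robots would
depend on the frame; here only one robot touches. -/
theorem followerStep_touched (hkj : k ≠ j) (hs : Sees x j k) (hd : dist (x k) (x j) = 1)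
    (hx : ∀ i, i ≠ j → i ≠ k → dist (x i) (x j) ≠ 1) :
    followerStep .idle (h (x j)) (snapshot h x j) =
      (.directed (h (x k) - h (x j)), h (x j)) := by
  have : (snapshot h x j).filter (fun q => dist q (h (x j)) = 1) = {h (x k)} := by
    ext q
    simp only [Finset.mem_filter, mem_snapshot, Finset.mem_singleton]
    constructor
    · rintro ⟨⟨i, ⟨hi, -⟩, rfl⟩, hq⟩
      by_contra hne
      exact hx i hi (fun e => hne (by rw [e])) (by simpa using hq)
    · rintro rfl
      exact ⟨⟨k, ⟨hkj, hs⟩, rfl⟩, by simpa using hd⟩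
  simp only [followerStep]
  rw [show ordered _ = ordered {h (x k)} by rw [← this], ordered_head?_singleton]

theorem isometry_add_real_mul (a e : ℂ) (s : ℝ) :
    h (a + s * e) = h a + s * (h (a + e) - h a) := by
  have h1 (v : ℂ) : h (a + v) = h a + h.linearIsometryEquiv v := by
    rw [add_comm, ← vadd_eq_add, h.map_vadd, vadd_eq_add, add_comm]
  rw [h1, h1, add_sub_cancel_left, ← Complex.real_smul, ← Complex.real_smul, map_smul]

/-- Since `e` is a unit vector, the parameter on the ray is the distance. The minimality hypothesis
ranges over all robots, so visibility has to be known for `k` only. -/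
theorem followerStep_directed {e : ℂ} (he : ‖e‖ = 1) {s : ℝ} (hs : 0 < s)
    (hkj : k ≠ j) (hsee : Sees x j k) (hk : x k = x j + s * e)
    (hx : ∀ i, i ≠ j → ∀ s' : ℝ, 0 < s' → x i = x j + s' * e → s ≤ s') :
    followerStep (.directed (h (x j + e) - h (x j))) (h (x j)) (snapshot h x j) =
      (.instructed (h (x k)), h (x j)) := by
  classical
  set A := ((snapshot h x j).filter fun q => ∃ s : ℝ, 0 < s ∧
    q = h (x j) + s * (h (x j + e) - h (x j))).image (dist (h (x j))) with hA
  have hdist (s : ℝ) (hs : 0 < s) : dist (x j) (x j + s * e) = s := by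
    simp [he, abs_of_pos hs]
  have hmem : s ∈ A := by
    refine Finset.mem_image.2 ⟨h (x k), Finset.mem_filter.2 ⟨mem_snapshot.2 ⟨k, ⟨hkj, hsee⟩, rfl⟩,
      s, hs, ?_⟩, ?_⟩
    · rw [hk, isometry_add_real_mul]
    · rw [h.dist_map, hk, hdist s hs]
  have hmin : A.min' ⟨s, hmem⟩ = s := by
    refine le_antisymm (Finset.min'_le _ _ hmem) (Finset.le_min' _ _ _ fun y hy => ?_)
    obtain ⟨q, hq, rfl⟩ := Finset.mem_image.1 hy
    obtain ⟨hq, s', hs', hqs⟩ := Finset.mem_filter.1 hq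
    obtain ⟨i, ⟨hi, -⟩, rfl⟩ := mem_snapshot.1 hq
    rw [← isometry_add_real_mul] at hqs
    have hqs := h.injective hqs
    rw [h.dist_map, hqs, hdist s' hs']
    exact hx i hi s' hs' hqs
  have hne : A.Nonempty := ⟨s, hmem⟩
  have key : followerStep (.directed (h (x j + e) - h (x j))) (h (x j)) (snapshot h x j) =
      if h' : A.Nonempty then
        (.instructed (h (x j) + (A.min' h' : ℝ) * (h (x j + e) - h (x j))), h (x j))
      else (.idle, h (x j)) := by
    simp only [followerStep]
    congr!
  rw [key, dif_pos hne, hmin, hk, isometry_add_real_mul]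

theorem followerStep_instructed {dest : ℂ} (hx : ∀ k, k ≠ j → 1 ≤ dist (x k) dest) :
    followerStep (.instructed (h dest)) (h (x j)) (snapshot h x j) = (.idle, h dest) := by
  simp only [followerStep]
  rw [if_neg]
  rintro ⟨q, hq, hd⟩
  obtain ⟨k, ⟨hk, -⟩, rfl⟩ := mem_snapshot.1 hq
  rw [h.dist_map] at hd
  exact absurd hd (not_lt.2 (hx k hk))

end Follower

/-! ### Quarter turns and memory -/

/-- The four quarter turns of the half-open second quadrant partition the punctured plane. -/
theorem quarterTurns_spec {u : ℂ} (hu : u ≠ 0) :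
    (I ^ (quarterTurns u : ℕ) * u).re < 0 ∧ 0 ≤ (I ^ (quarterTurns u : ℕ) * u).im := by
  unfold quarterTurns
  split_ifs with h0 h1 h2
  · simpa using h0
  · simpa using h1
  · simpa using h2
  · have h3 : ((3 : Fin 4) : ℕ) = 3 := rfl
    simp only [h3, pow_succ, pow_zero, one_mul, mul_re, mul_im, I_re, I_im] at h0 h1 h2 ⊢
    norm_num at h0 h1 h2 ⊢
    have hu' : u.re ≠ 0 ∨ u.im ≠ 0 := by
      by_contra! h
      exact hu (Complex.ext h.1 h.2)
    grind

/-- A number up to `n` has at most one digit in base `n + 1`. -/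
theorem intUnits_le_one {n m : ℕ} (h : m ≤ n) : intUnits n m ≤ 1 := by
  rcases Nat.eq_zero_or_pos m with rfl | hm
  · simp [intUnits]
  · simp [intUnits, Nat.digits_of_lt (n + 1) m hm.ne' (by omega)]

theorem leaderMove_next {P : Pattern} {m : LeaderMemory} {C self f : ℂ}
    {seen : Finset ℂ} (hm : m.stage = .next)
    (hlt : m.index < P.points.card ∧ m.index + 1 < m.count) (hf : f ∈ seen)
    (hfre : m.corner.re ≤ f.re) (hmin : ∀ z ∈ seen, m.corner.re ≤ z.re → LeftTop f z) :
    leaderMove P m C self seen =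
      ({ m with stage := .beside, aim := f }, ⟨f.re - 1, self.im⟩) := by
  simp only [leaderMove, hm]
  rw [if_pos hlt, ordered_headD_eq (Finset.mem_filter.2 ⟨hf, hfre⟩)
    fun z hz => hmin z (Finset.mem_filter.1 hz).1 (Finset.mem_filter.1 hz).2]

/-! ### The scene of the phase, in the turned coordinate system of the leader -/

/-- The data of the phase, where the global coordinate system is the one of the leader after
its turn. -/
structure Scene (n : ℕ) where
  P : Pattern
  frame : Fin n → ℂ ≃ᵃⁱ[ℝ] ℂ
  start : Fin n → ℂ
  l : Fin n
  c : ℂ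
  turn : Fin 4
  card_le : P.points.card ≤ n
  elected : LeaderElected start l c
  frame_leader : ∀ z, I ^ (turn : ℕ) * frame l z = z
  turn_eq : quarterTurns (frame l (start l) - frame l c) = turn

namespace Scene

variable {n : ℕ} (S : Scene n)

open Classical in
/-- The start positions of the followers. -/
def followers : Finset ℂ := (Finset.univ.erase S.l).image S.start

/-- The place of a follower in the order from left to right, counted from 0. -/
def rank (j : Fin n) : ℕ := (ordered S.followers).idxOf (S.start j)

/-- The point `(x_min, y_max)`. -/
def corner : ℂ :=
  ⟨(insert (S.start S.l) S.followers).inf' (Finset.insert_nonempty _ _) Complex.re,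
   (insert (S.start S.l) S.followers).sup' (Finset.insert_nonempty _ _) Complex.im⟩

/-- The abscissa of the corridor between the start positions and the pattern. -/
def corridor : ℝ := S.corner.re - 90

def slot (i : ℕ) : ℂ := S.P.slot S.corner i

/-- The position of follower `j` when the followers of rank less than `i` have been placed. -/
def rest (i : ℕ) (j : Fin n) : ℂ := if S.rank j < i then S.slot (S.rank j) else S.start j

/-- The positions when the leader is at `L`, the robot `f` at `a`, and from the others those of rank
less than `i` have been placed. For `f = S.l` there is no robot `f` apart from the leader. -/
def place (i : ℕ) (f : Fin n) (L a : ℂ) (j : Fin n) : ℂ :=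
  if j = S.l then L else if j = f then a else S.rest i j

/-- All followers except `f` are at distance more than 1 from `z`. -/
def Clear (i : ℕ) (f : Fin n) (z : ℂ) : Prop := ∀ j, j ≠ S.l → j ≠ f → 1 < dist z (S.rest i j)

/-! ### Basic facts on starts and ranks -/

theorem n_pos (S : Scene n) : 0 < n :=
  have := S.l.isLt
  by omega

theorem start_injective : Function.Injective S.start := fun i j h => by
  by_contra hij
  have := S.elected.apart i j hij
  rw [h, dist_self] at this
  linarith

theorem start_mem_followers {j : Fin n} (hj : j ≠ S.l) : S.start j ∈ S.followers := by
  classical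
  exact Finset.mem_image_of_mem _ (Finset.mem_erase.2 ⟨hj, Finset.mem_univ _⟩)

theorem start_mem (j : Fin n) : S.start j ∈ insert (S.start S.l) S.followers := by
  by_cases h : j = S.l
  · simp [h]
  · exact Finset.mem_insert_of_mem (S.start_mem_followers h)

theorem mem_followers {z : ℂ} : z ∈ S.followers ↔ ∃ j, j ≠ S.l ∧ S.start j = z := by
  simp [followers]

theorem corner_re_le (j : Fin n) : S.corner.re ≤ (S.start j).re :=
  Finset.inf'_le Complex.re (S.start_mem j)

theorem le_corner_im (j : Fin n) : (S.start j).im ≤ S.corner.im :=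
  Finset.le_sup' Complex.im (S.start_mem j)

theorem card_followers : S.followers.card = n - 1 := by
  classical
  rw [followers, Finset.card_image_of_injective _ S.start_injective,
    Finset.card_erase_of_mem (Finset.mem_univ _), Finset.card_univ, Fintype.card_fin]

theorem length_ordered : (ordered S.followers).length = n - 1 := by
  rw [ordered, Finset.length_sort, card_followers]

theorem rank_lt {j : Fin n} (hj : j ≠ S.l) : S.rank j < n - 1 := by
  rw [← S.length_ordered]
  exact List.idxOf_lt_length_iff.2 ((Finset.mem_sort (r := LeftTop)).2 (S.start_mem_followers hj))

theorem getElem_rank {j : Fin n} (h : S.rank j < (ordered S.followers).length) :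
    (ordered S.followers)[S.rank j] = S.start j :=
  List.getElem_idxOf h

theorem rank_of_getElem {j : Fin n} {i : ℕ} (h : (ordered S.followers)[i]? = some (S.start j)) :
    S.rank j = i := by
  obtain ⟨hi, h⟩ := List.getElem?_eq_some_iff.1 h
  rw [rank, ← h]
  exact List.Nodup.idxOf_getElem (Finset.sort_nodup _ _) i hi

theorem rank_inj {j k : Fin n} (hj : j ≠ S.l) (hk : k ≠ S.l) (h : S.rank j = S.rank k) :
    j = k := by
  have hj' := S.rank_lt hj
  have hk' := S.rank_lt hk
  rw [← S.length_ordered] at hj' hk'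
  refine S.start_injective ?_
  rw [← S.getElem_rank hj', ← S.getElem_rank hk']
  simp [h]

theorem exists_rank {i : ℕ} (hi : i < n - 1) : ∃ f, f ≠ S.l ∧ S.rank f = i := by
  rw [← S.length_ordered] at hi
  obtain ⟨j, hj, hji⟩ := S.mem_followers.1
    ((Finset.mem_sort (r := LeftTop)).1 (List.getElem_mem hi))
  exact ⟨j, hj, S.rank_of_getElem (List.getElem?_eq_some_iff.2 ⟨hi, hji.symm⟩)⟩

theorem leftTop_start {j k : Fin n} (hk : k ≠ S.l) (h : S.rank j ≤ S.rank k) :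
    LeftTop (S.start j) (S.start k) := by
  have hk' := S.rank_lt hk
  rw [← S.length_ordered] at hk'
  have := ordered_getElem_leftTop S.followers h hk'
  rwa [S.getElem_rank, S.getElem_rank] at this

/-! ### The slots -/

theorem slot_eq {i : ℕ} (hi : i < (ordered S.P.points).length) :
    S.slot i = 5 * (ordered S.P.points)[i] + S.P.shift S.corner := by
  rw [slot, Pattern.slot, List.getD_eq_getElem _ _ hi]

theorem length_ordered_points : (ordered S.P.points).length = S.P.points.card := by
  rw [ordered, Finset.length_sort]

theorem shifted_re {p : ℂ} (hp : p ∈ S.P.points) :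
    (5 * p + S.P.shift S.corner).re ≤ S.corner.re - 100 := by
  have := Finset.le_sup' Complex.re hp
  simp only [Pattern.shift, add_re, mul_re, re_ofNat, im_ofNat, zero_mul, sub_zero]
  linarith

theorem shifted_im {p : ℂ} (hp : p ∈ S.P.points) :
    S.corner.im + 100 ≤ (5 * p + S.P.shift S.corner).im := by
  have := Finset.inf'_le Complex.im hp
  simp only [Pattern.shift, add_im, mul_im, re_ofNat, im_ofNat, zero_mul, add_zero]
  linarith

theorem slot_bounds {i : ℕ} (hi : i < S.P.points.card) :
    (S.slot i).re ≤ S.corner.re - 100 ∧ S.corner.im + 100 ≤ (S.slot i).im := by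
  rw [← S.length_ordered_points] at hi
  have hp := (Finset.mem_sort (r := LeftTop)).1 (List.getElem_mem hi)
  rw [S.slot_eq hi]
  exact ⟨S.shifted_re hp, S.shifted_im hp⟩

theorem dist_slot {i j : ℕ} (hi : i < S.P.points.card) (hj : j < S.P.points.card) (hij : i ≠ j) :
    5 ≤ dist (S.slot i) (S.slot j) := by
  rw [← S.length_ordered_points] at hi hj
  have hp := (Finset.mem_sort (r := LeftTop)).1 (List.getElem_mem hi)
  have hq := (Finset.mem_sort (r := LeftTop)).1 (List.getElem_mem hj)
  have h := S.P.separated _ hp _ hq fun h =>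
    hij ((List.Nodup.getElem_inj_iff (Finset.sort_nodup _ _)).1 h)
  rw [S.slot_eq hi, S.slot_eq hj, dist_add_right, dist_eq_norm, ← mul_sub, norm_mul,
    ← dist_eq_norm]
  simp only [Complex.norm_ofNat]
  linarith!

theorem leftTop_slot {i j : ℕ} (hij : i ≤ j) (hj : j < S.P.points.card) :
    LeftTop (S.slot i) (S.slot j) := by
  rw [← S.length_ordered_points] at hj
  have := ordered_getElem_leftTop S.P.points hij hj
  rw [S.slot_eq hj, S.slot_eq (hij.trans_lt hj)]
  rcases this with h | ⟨h, h'⟩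
  · left
    simp
    linarith
  · right
    simp [h]
    linarith

/-! ### Clear points -/

theorem clear_of {i : ℕ} {f : Fin n} {z : ℂ}
    (hp : ∀ m < i, 1 < dist z (S.slot m))
    (hw : ∀ j, j ≠ S.l → j ≠ f → i ≤ S.rank j → 1 < dist z (S.start j)) : S.Clear i f z := by
  intro j hj hjf
  unfold rest
  split_ifs with h
  · exact hp _ h
  · exact hw j hj hjf (not_lt.1 h)

theorem slots_clear_of_re {i : ℕ} (hi : i ≤ S.P.points.card) {z : ℂ}
    (hz : S.corner.re - 99 < z.re) : ∀ m < i, 1 < dist z (S.slot m) := by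
  intro m hm
  have := re_sub_le_dist z (S.slot m)
  have := (S.slot_bounds (hm.trans_le hi)).1
  linarith

/-- An earlier slot is not to the right of slot `i`. If it is more than 1 further left, the
abscissas suffice. Otherwise distance at least 5 forces a vertical gap above 4, of which the descent
by at most 2 leaves more than 2. This is where the factor 5 and filling from left to right are used.
-/
theorem slots_clear_of_slot {i : ℕ} (hi : i < S.P.points.card) {z : ℂ}
    (hre : (S.slot i).re ≤ z.re) (him : z.im ≤ (S.slot i).im) (him' : (S.slot i).im - 2 ≤ z.im) :
    ∀ m < i, 1 < dist z (S.slot m) := by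
  intro m hm
  have h1 := re_le_of_leftTop (S.leftTop_slot hm.le hi)
  have h2 := sq_le_of_le_dist (by norm_num) (S.dist_slot hi (hm.trans hi) hm.ne')
  by_cases hX : 1 < (S.slot i).re - (S.slot m).re
  · have := re_sub_le_dist z (S.slot m)
    linarith
  · have hY : 4 < |(S.slot i).im - (S.slot m).im| := by
      refine lt_of_pow_lt_pow_left₀ 2 (abs_nonneg _) ?_
      rw [sq_abs]
      nlinarith
    have h3 := im_sub_le_dist z (S.slot m)
    have h4 := im_sub_le_dist (S.slot m) z
    rw [dist_comm] at h4
    rcases lt_abs.1 hY with h | h <;> linarith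

theorem starts_clear_of_re {z : ℂ} (hz : z.re < S.corner.re - 1) (j : Fin n) :
    1 < dist z (S.start j) := by
  have := re_sub_le_dist (S.start j) z
  rw [dist_comm] at this
  linarith [S.corner_re_le j]

theorem starts_clear_of_im {z : ℂ} (hz : S.corner.im + 1 < z.im) (j : Fin n) :
    1 < dist z (S.start j) := by
  have := im_sub_le_dist z (S.start j)
  linarith [S.le_corner_im j]

/-- Robot `j` is not to the left of `f`, so a horizontal move to the left from `f` only increases
the distance to `j`. -/
theorem starts_clear_of_left {f j : Fin n} (hj : j ≠ S.l) (hjf : j ≠ f)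
    (h : S.rank f ≤ S.rank j) {z : ℂ} (him : z.im = (S.start f).im)
    (hre : z.re ≤ (S.start f).re) : 1 < dist z (S.start j) := by
  have h1 := re_le_of_leftTop (S.leftTop_start hj h)
  have h2 := sq_lt_of_lt_dist (by norm_num) (S.elected.apart f j hjf.symm)
  refine lt_dist_of_sq ?_
  rw [him]
  nlinarith

/-- The critical case is a `j` with the abscissa of `f`, at horizontal distance exactly 1 from `z`.
Ties are broken from top to bottom, so `j` is strictly below `f` and hence below `z`. The leader may
therefore come down to `f` from above. -/
theorem starts_clear_of_beside {f j : Fin n} (hj : j ≠ S.l) (hjf : j ≠ f)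
    (h : S.rank f ≤ S.rank j) {z : ℂ} (hz : z.re < (S.start f).re - 1 ∨
      z.re = (S.start f).re - 1 ∧ (S.start f).im ≤ z.im) : 1 < dist z (S.start j) := by
  have h3 := re_sub_le_dist (S.start j) z
  rw [dist_comm] at h3
  have h4 := S.leftTop_start hj h
  have h1 := re_le_of_leftTop h4
  rcases hz with hz | ⟨hz, hz'⟩
  · linarith
  rcases h4 with h4 | ⟨h4, h5⟩
  · linarith
  have h6 : (S.start j).im < (S.start f).im :=
    h5.lt_of_ne fun e => hjf (S.start_injective (Complex.ext h4.symm e))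
  refine lt_dist_of_sq ?_
  nlinarith

theorem one_lt_dist_rest {i : ℕ} (hi : i ≤ S.P.points.card) {j k : Fin n} (hj : j ≠ S.l)
    (hk : k ≠ S.l) (hjk : j ≠ k) : 1 < dist (S.rest i j) (S.rest i k) := by
  unfold rest
  split_ifs with h h' h'
  · have := S.dist_slot (h.trans_le hi) (h'.trans_le hi) fun e => hjk (S.rank_inj hj hk e)
    linarith
  · have := (S.slot_bounds (h.trans_le hi)).1
    exact S.starts_clear_of_re (by linarith) _
  · have := (S.slot_bounds (h'.trans_le hi)).1
    rw [dist_comm]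
    exact S.starts_clear_of_re (by linarith) _
  · exact S.elected.apart j k hjk

/-! ### Changing the number of placed followers -/

/-- An active robot that has reached its slot counts as placed. With `S.l` in the role of the active
robot the point `a` is a dummy; likewise in `place_rank`. -/
theorem place_succ {f : Fin n} (hf : f ≠ S.l) (L a : ℂ) :
    S.place (S.rank f + 1) S.l L a = S.place (S.rank f) f L (S.slot (S.rank f)) := by
  funext j
  unfold place rest
  by_cases hj : j = S.l
  · simp [hj]
  by_cases hjf : j = f
  · simp [hjf, hf]
  have : S.rank j ≠ S.rank f := fun e => hjf (S.rank_inj hj hf e)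
  simp only [hj, hjf, if_false]
  congr 1
  simp only [eq_iff_iff]
  omega

theorem place_rank (f : Fin n) (L a : ℂ) :
    S.place (S.rank f) f L (S.start f) = S.place (S.rank f) S.l L a := by
  funext j
  unfold place rest
  by_cases hj : j = S.l
  · simp [hj]
  by_cases hjf : j = f
  · subst hjf
    simp [hj]
  simp [hj, hjf]

theorem place_leader (i : ℕ) (f : Fin n) (L a : ℂ) : S.place i f L a S.l = L := by
  simp [place]

theorem place_active (i : ℕ) {f : Fin n} (hf : f ≠ S.l) (L a : ℂ) : S.place i f L a f = a := by
  simp [place, hf]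

theorem place_other (i : ℕ) {f j : Fin n} (hj : j ≠ S.l) (hjf : j ≠ f) (L a : ℂ) :
    S.place i f L a j = S.rest i j := by
  simp [place, hj, hjf]

/-- If nothing stands in the way of the leader and of `f`, then no two robots are too close. -/
theorem le_dist_place {i : ℕ} (hi : i ≤ S.P.points.card) {f : Fin n} {L a : ℂ}
    (hL : S.Clear i f L) (ha : f ≠ S.l → S.Clear i f a) (hLa : f ≠ S.l → 1 ≤ dist L a)
    {j k : Fin n} (hjk : j ≠ k) : 1 ≤ dist (S.place i f L a j) (S.place i f L a k) := by
  unfold place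
  split_ifs with h1 h2 h3 h4 h5 h6 h7
  · exact absurd (h1.trans h2.symm) hjk
  · subst h3; exact hLa h2
  · exact (hL k h2 h3).le
  · subst h4; rw [dist_comm]; exact hLa h1
  · exact absurd (h4.trans h6.symm) hjk
  · subst h4; exact (ha h1 k h5 h6).le
  · rw [dist_comm]; exact (hL j h1 h4).le
  · subst k; rw [dist_comm]; exact (ha h7 j h1 h4).le
  · exact (S.one_lt_dist_rest hi h1 ‹_› hjk).le

/-- This keeps all robots other than the leader and `f` idle. -/
theorem dist_place_ne_one {i : ℕ} (hi : i ≤ S.P.points.card) {f : Fin n} {L a : ℂ}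
    (hL : S.Clear i f L) (ha : f ≠ S.l → S.Clear i f a)
    {j k : Fin n} (hj : j ≠ S.l) (hjf : j ≠ f) (hjk : k ≠ j) :
    dist (S.place i f L a k) (S.place i f L a j) ≠ 1 := by
  refine ne_of_gt ?_
  rw [S.place_other i hj hjf]
  unfold place
  split_ifs with h1 h2
  · exact hL j hj hjf
  · exact ha (fun e => h1 (h2.trans e)) j hj hjf
  · exact S.one_lt_dist_rest hi h1 hj hjk

/-- Any two points on the paths of two robots occur together in one frozen placement `S.place i f z
y`, so the static bound `le_dist_place` applies. -/
theorem collisionFree_place {i : ℕ} (hi : i ≤ S.P.points.card) {f : Fin n} {L a L' a' : ℂ}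
    (hL : ∀ z ∈ segment ℝ L L', S.Clear i f z)
    (ha : f ≠ S.l → ∀ y ∈ segment ℝ a a', S.Clear i f y)
    (hLa : f ≠ S.l → ∀ z ∈ segment ℝ L L', ∀ y ∈ segment ℝ a a', 1 ≤ dist z y) :
    CollisionFree (S.place i f L a) (S.place i f L' a') := by
  have key (z) (hz : z ∈ segment ℝ L L') (y) (hy : y ∈ segment ℝ a a') {j k : Fin n}
      (hjk : j ≠ k) : 1 ≤ dist (S.place i f z y j) (S.place i f z y k) :=
    S.le_dist_place hi (hL z hz) (fun h => ha h y hy) (fun h => hLa h z hz y hy) hjk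
  have hpath (j) (x) (hx : x ∈ segment ℝ (S.place i f L a j) (S.place i f L' a' j)) :
      (j = S.l ∧ x ∈ segment ℝ L L') ∨ (j ≠ S.l ∧ j = f ∧ x ∈ segment ℝ a a') ∨
        (j ≠ S.l ∧ j ≠ f ∧ x = S.rest i j) := by
    unfold place at hx
    split_ifs at hx with h1 h2
    · exact Or.inl ⟨h1, hx⟩
    · exact Or.inr (Or.inl ⟨h1, h2, hx⟩)
    · rw [segment_same] at hx
      exact Or.inr (Or.inr ⟨h1, h2, hx⟩)
  have hl := left_mem_segment ℝ L L'
  have hl' := left_mem_segment ℝ a a'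
  intro j k hjk x hx y hy
  rcases hpath j x hx with ⟨h1, hx⟩ | ⟨h1, h2, hx⟩ | ⟨h1, h2, hx⟩ <;>
  rcases hpath k y hy with ⟨h3, hy⟩ | ⟨h3, h4, hy⟩ | ⟨h3, h4, hy⟩
  · exact absurd (h1.trans h3.symm) hjk
  · simpa [place, h1, h3, h4, h4 ▸ h3] using key x hx y hy hjk
  · simpa [place, h1, h3, h4, hy] using key x hx a hl' hjk
  · simpa [place, h1, h2, h3, h2 ▸ h1] using key y hy x hx hjk
  · exact absurd (h2.trans h4.symm) hjk
  · simpa [place, h1, h2, h3, h4, h2 ▸ h1, hy] using key L hl x hx hjk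
  · simpa [place, h1, h2, h3, hx] using key y hy a hl' hjk
  · simpa [place, h1, h2, h3, h4, h4 ▸ h3, hx] using key L hl y hy hjk
  · simpa [place, h1, h2, h3, h4, hx, hy] using key L hl a hl' hjk

end Scene

/-! ### Segments on a ray -/

theorem exists_of_mem_segment_ray {a e z : ℂ} {s₁ s₂ : ℝ} (h : s₁ ≤ s₂)
    (hz : z ∈ segment ℝ (a + s₁ * e) (a + s₂ * e)) :
    ∃ s : ℝ, s₁ ≤ s ∧ s ≤ s₂ ∧ z = a + s * e := by
  obtain ⟨α, β, hα, hβ, hαβ, rfl⟩ := hz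
  obtain rfl : α = 1 - β := by linarith
  refine ⟨(1 - β) * s₁ + β * s₂, ?_, ?_, ?_⟩
  · nlinarith [mul_le_mul_of_nonneg_left h hβ]
  · nlinarith [mul_le_mul_of_nonneg_left h hα]
  · simp only [real_smul]
    push_cast
    ring

theorem mem_segment_ray {a e : ℂ} {s s' : ℝ} (h : 0 ≤ s') (h' : s' ≤ s) :
    a + s' * e ∈ segment ℝ a (a + s * e) := by
  rcases (h.trans h').eq_or_lt with h0 | h0
  · obtain rfl : s' = 0 := by linarith
    simpa using left_mem_segment ℝ a _
  refine ⟨1 - s' / s, s' / s, ?_, by positivity, by ring, ?_⟩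
  · rw [sub_nonneg, div_le_one h0]
    exact h'
  · have : (s : ℂ) ≠ 0 := by exact_mod_cast h0.ne'
    simp only [real_smul]
    push_cast
    field_simp
    ring

/-! ### Single rounds, and the manoeuvre that moves a follower -/

namespace Scene

variable {n : ℕ} (S : Scene n)

/-- The configuration after `t` rounds. -/
def exec (t : ℕ) : Config n := execution S.P S.frame S.start S.l S.c t

theorem exec_succ (t : ℕ) : S.exec (t + 1) = round S.P S.frame (S.exec t) := by
  simp [exec, execution, Function.iterate_succ_apply']

/-- The configuration with positions `S.place i f L a`, where the leader has memory `m` and the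
robot `f` has memory `μ`, the other followers being idle. -/
def config (i : ℕ) (f : Fin n) (L a : ℂ) (m : LeaderMemory) (μ : FollowerMemory) : Config n where
  pos := S.place i f L a
  mem j := if j = S.l then .leader m else .follower (if j = f then μ else .idle)

/-- The requirements of the round number `t`. -/
structure Good (t : ℕ) : Prop where
  free : CollisionFree (S.exec t).pos (S.exec (t + 1)).pos
  units : ∀ i, ((S.exec t).mem i).units n ≤ 7
  single : ∀ i j, (S.exec (t + 1)).pos i ≠ (S.exec t).pos i →
    (S.exec (t + 1)).pos j ≠ (S.exec t).pos j → i = j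
  shown : ∀ j, j ≠ S.l → (S.exec (t + 1)).pos j ≠ (S.exec t).pos j →
    ∃ s, t = s + 2 ∧ (S.exec t).pos j = (S.exec s).pos j ∧
      dist ((S.exec s).pos S.l) ((S.exec s).pos j) = 1 ∧
      (S.exec (s + 1)).pos S.l = (S.exec (t + 1)).pos j ∧
      SameRay ℝ ((S.exec s).pos S.l - (S.exec s).pos j)
        ((S.exec (t + 1)).pos j - (S.exec s).pos j)

/-- A leader memory whose integers are in range. -/
def InRange (_ : Scene n) (m : LeaderMemory) : Prop := m.count ≤ n ∧ m.index ≤ n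

/-- A leader memory after departure. -/
def Departed (m : LeaderMemory) : Prop := m.stage ≠ .depart ∧ m.turn = S.turn

theorem neg_I_pow_mul (z : ℂ) : (-I) ^ (S.turn : ℕ) * z = S.frame S.l z := by
  conv_lhs => rw [← S.frame_leader z, ← mul_assoc, ← mul_pow]
  simp

theorem image_snapshot (x : Fin n → ℂ) :
    (snapshot (S.frame S.l) x S.l).image (fun q => I ^ (S.turn : ℕ) * q) = visible x S.l := by
  ext z
  simp only [Finset.mem_image, mem_snapshot, mem_visible]
  constructor
  · rintro ⟨_, ⟨j, hj, rfl⟩, rfl⟩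
    exact ⟨j, hj, (S.frame_leader _).symm⟩
  · rintro ⟨j, hj, rfl⟩
    exact ⟨_, ⟨j, hj, rfl⟩, S.frame_leader _⟩

theorem leaderStep_eq {m m' : LeaderMemory} {y : ℂ} (hm : S.Departed m) (x : Fin n → ℂ)
    (h : leaderMove S.P m (I ^ (S.turn : ℕ) * m.centre) (x S.l) (visible x S.l) = (m', y)) :
    leaderStep S.P m (S.frame S.l (x S.l)) (snapshot (S.frame S.l) x S.l) =
      (m', S.frame S.l y) := by
  have ho : m.orient (S.frame S.l (x S.l)) = m := by
    obtain ⟨σ, _⟩ := m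
    cases σ <;> first | rfl | exact absurd rfl hm.1
  simp only [leaderStep, ho, hm.2, S.frame_leader, S.neg_I_pow_mul]
  rw [S.image_snapshot, h]

variable {S}

/-- Everyone but the leader and `f` is idle and untouched, so a round reduces to two local
computations. If `f = S.l`, the one for `f` disappears. -/
theorem round_config {i : ℕ} {f : Fin n} {L a L' a' : ℂ} {m m' : LeaderMemory}
    {μ μ' : FollowerMemory} (hi : i ≤ S.P.points.card) (hL : S.Clear i f L)
    (ha : f ≠ S.l → S.Clear i f a) (hm : S.Departed m)
    (hlead : ∀ seen, seen = visible (S.place i f L a) S.l →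
      leaderMove S.P m (I ^ (S.turn : ℕ) * m.centre) L seen = (m', L'))
    (hfol : f ≠ S.l → followerStep μ (S.frame f a) (snapshot (S.frame f) (S.place i f L a) f) =
      (μ', S.frame f a')) :
    round S.P S.frame (S.config i f L a m μ) = S.config i f L' a' m' μ' := by
  have key (j) : compute S.P S.frame (S.config i f L a m μ) j =
      ((S.config i f L' a' m' μ').mem j, S.frame j ((S.config i f L' a' m' μ').pos j)) := by
    by_cases hj : j = S.l
    · subst hj
      have := S.leaderStep_eq hm (S.place i f L a) (m' := m') (y := L') (by
        rw [place_leader]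
        exact hlead _ rfl)
      rw [place_leader] at this
      simp only [compute, config, robotStep, if_true, this, place_leader]
    by_cases hjf : j = f
    · subst hjf
      simp [compute, config, robotStep, hj, place_active, hfol hj]
    · have := followerStep_untouched (S.frame j) (x := S.place i f L a) (j := j)
        fun k hk => S.dist_place_ne_one hi hL ha hj hjf hk
      simp only [compute, config, robotStep, hj, hjf, if_false, this]
      simp [place_other, hj, hjf]
  simp only [round, key]
  simp

theorem exec_succ_config {t i : ℕ} {f : Fin n} {L a L' a' : ℂ} {m m' : LeaderMemory}
    {μ μ' : FollowerMemory} (h : S.exec t = S.config i f L a m μ)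
    (hi : i ≤ S.P.points.card) (hL : S.Clear i f L)
    (ha : f ≠ S.l → S.Clear i f a) (hm : S.Departed m)
    (hlead : ∀ seen, seen = visible (S.place i f L a) S.l →
      leaderMove S.P m (I ^ (S.turn : ℕ) * m.centre) L seen = (m', L'))
    (hfol : f ≠ S.l → followerStep μ (S.frame f a) (snapshot (S.frame f) (S.place i f L a) f) =
      (μ', S.frame f a')) :
    S.exec (t + 1) = S.config i f L' a' m' μ' := by
  rw [exec_succ, h, round_config hi hL ha hm hlead hfol]

theorem units_config {i : ℕ} {f : Fin n} {L a : ℂ} {m : LeaderMemory} {μ : FollowerMemory}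
    (hm : S.InRange m) (j : Fin n) : ((S.config i f L a m μ).mem j).units n ≤ 7 := by
  have h1 := intUnits_le_one hm.1
  have h2 := intUnits_le_one hm.2
  simp only [config]
  split_ifs
  · simp only [Memory.units]
    omega
  · cases μ <;> simp [Memory.units]
  · simp [Memory.units]

theorem good_of_leader_moves {t i : ℕ} {f : Fin n} {L a L' : ℂ} {m m' : LeaderMemory}
    {μ μ' : FollowerMemory} (h : S.exec t = S.config i f L a m μ)
    (h' : S.exec (t + 1) = S.config i f L' a m' μ') (hi : i ≤ S.P.points.card)
    (hm : S.InRange m) (hL : ∀ z ∈ segment ℝ L L', S.Clear i f z)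
    (ha : f ≠ S.l → S.Clear i f a) (hLa : f ≠ S.l → ∀ z ∈ segment ℝ L L', 1 ≤ dist z a) :
    S.Good t := by
  have hstay (j) (hj : (S.exec (t + 1)).pos j ≠ (S.exec t).pos j) : j = S.l := by
    by_contra hjl
    simp [h, h', config, place, hjl] at hj
  refine ⟨?_, ?_, fun j k hj hk => (hstay j hj).trans (hstay k hk).symm,
    fun j hj hj' => absurd (hstay j hj') hj⟩
  · rw [h, h']
    refine S.collisionFree_place hi hL (fun hf y hy => ?_) (fun hf z hz y hy => ?_) <;>
    rw [segment_same, Set.mem_singleton_iff] at hy <;> subst hy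
    · exact ha hf
    · exact hLa hf z hz
  · rw [h]
    exact units_config hm

theorem good_of_active_moves {s i : ℕ} {f : Fin n} {L₀ L a a' : ℂ} {m₀ m₁ m m' : LeaderMemory}
    {μ₀ μ₁ μ μ' : FollowerMemory} (h₀ : S.exec s = S.config i f L₀ a m₀ μ₀)
    (h₁ : S.exec (s + 1) = S.config i f a' a m₁ μ₁)
    (h : S.exec (s + 2) = S.config i f L a m μ)
    (h' : S.exec (s + 3) = S.config i f L a' m' μ') (hi : i ≤ S.P.points.card) (hf : f ≠ S.l)
    (hm : S.InRange m) (hL : S.Clear i f L) (ha : ∀ z ∈ segment ℝ a a', S.Clear i f z)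
    (hLa : ∀ z ∈ segment ℝ a a', 1 ≤ dist L z) (hd : dist L₀ a = 1)
    (hray : SameRay ℝ (L₀ - a) (a' - a)) : S.Good (s + 2) := by
  have hstay (j) (hj : (S.exec (s + 3)).pos j ≠ (S.exec (s + 2)).pos j) : j = f := by
    by_contra hjf
    simp [h, h', config, place, hjf] at hj
  refine ⟨?_, ?_, fun j k hj hk => (hstay j hj).trans (hstay k hk).symm, fun j hj hj' => ?_⟩
  · rw [h, h']
    refine S.collisionFree_place hi (fun z hz => ?_) (fun _ => ha) (fun _ z hz y hy => ?_) <;>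
    rw [segment_same, Set.mem_singleton_iff] at hz <;> subst hz
    · exact hL
    · exact hLa y hy
  · rw [h]
    exact units_config hm
  · obtain rfl := hstay j hj'
    exact ⟨s, rfl, by simpa [h₀, h₁, h, h', config, place, hj] using ⟨hd, hray⟩⟩

/-- The leader, touching the robot `f` in the direction `e`, shows it the way to the point `b` in
that direction and then stands by at `b + u`. -/
theorem leg {t i : ℕ} {f : Fin n} {a b e u : ℂ} {s : ℝ} {m₀ m₁ m₂ m₃ : LeaderMemory}
    (h₀ : S.exec t = S.config i f (a + e) a m₀ .idle) (hi : i ≤ S.P.points.card) (hf : f ≠ S.l)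
    (he : ‖e‖ = 1) (hs : 1 ≤ s) (hb : b = a + s * e)
    (hm₀ : S.Departed m₀) (hm₁ : S.Departed m₁) (hm₂ : S.Departed m₂)
    (hr₀ : S.InRange m₀) (hr₁ : S.InRange m₁) (hr₂ : S.InRange m₂)
    (hl₀ : ∀ C seen, leaderMove S.P m₀ C (a + e) seen = (m₁, b))
    (hl₁ : ∀ C seen, leaderMove S.P m₁ C b seen = (m₂, b + u))
    (hl₂ : ∀ C seen, leaderMove S.P m₂ C (b + u) seen = (m₃, b + u))
    (hc : ∀ z ∈ segment ℝ a b, S.Clear i f z) (hc' : ∀ z ∈ segment ℝ b (b + u), S.Clear i f z)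
    (hd : ∀ z ∈ segment ℝ a b, 1 ≤ dist (b + u) z)
    (hd' : ∀ z ∈ segment ℝ b (b + u), 1 ≤ dist z a) :
    S.exec (t + 3) = S.config i f (b + u) b m₃ .idle ∧
      S.Good t ∧ S.Good (t + 1) ∧ S.Good (t + 2) := by
  have hs0 : 0 < s := by linarith
  have hae : a + e = a + (1 : ℝ) * e := by simp
  have hmem (s' : ℝ) (h : 0 ≤ s') (h' : s' ≤ s) : a + s' * e ∈ segment ℝ a b :=
    hb ▸ mem_segment_ray h h'
  have ha_mem := left_mem_segment ℝ a b
  have hb_mem := right_mem_segment ℝ a b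
  have hae_mem : a + e ∈ segment ℝ a b := hae ▸ hmem 1 (by norm_num) hs
  have hdist (s' : ℝ) (h : 0 ≤ s') : dist (a + s' * e) a = s' := by simp [he, abs_of_nonneg h]
  have hda : dist (a + e) a = 1 := by simp [he]
  have hdb : dist b a = s := by rw [hb]; exact hdist s hs0.le
  have hne (L : ℂ) (z) (hz : z ∈ segment ℝ a b) :
      ∀ k, k ≠ f → k ≠ S.l → 1 < dist z (S.place i f L a k) := fun k hkf hkl => by
    rw [S.place_other i hkl hkf]
    exact hc z hz k hkl hkf
  have hsub : segment ℝ (a + e) b ⊆ segment ℝ a b :=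
    (convex_segment _ _).segment_subset hae_mem hb_mem
  have hsee (L : ℂ) (hL : L ∈ segment ℝ a b) (hLa : 1 ≤ dist L a) :
      Sees (S.place i f L a) f S.l := by
    refine sees_of_segment ?_ fun z hz k hkf hkl => ?_ <;>
    rw [S.place_active i hf, S.place_leader] at *
    · rwa [dist_comm]
    · exact hne L z ((convex_segment _ _).segment_subset ha_mem hL hz) k hkf hkl
  -- At the start of this round the leader is the only robot touching `f`; it leaves for `b` while
  -- `f` stores the direction.
  have h₁ : S.exec (t + 1) = S.config i f b a m₁ (.directed (S.frame f (a + e) - S.frame f a)) := by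
    refine exec_succ_config h₀ hi (hc _ hae_mem) (fun _ => hc a ha_mem) hm₀
      (fun _ _ => hl₀ _ _) fun _ => ?_
    have := followerStep_touched (S.frame f) (x := S.place i f (a + e) a) (j := f) (k := S.l)
      hf.symm (hsee _ hae_mem hda.ge) (by rwa [S.place_active i hf, S.place_leader])
      fun k hkf hkl => by
        rw [S.place_active i hf, dist_comm]
        exact (hne _ a ha_mem k hkf hkl).ne'
    rwa [S.place_active i hf, S.place_leader] at this
  have h₂ : S.exec (t + 2) = S.config i f (b + u) a m₂ (.instructed (S.frame f b)) := by
    refine exec_succ_config h₁ hi (hc _ hb_mem) (fun _ => hc a ha_mem) hm₁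
      (fun _ _ => hl₁ _ _) fun _ => ?_
    have := followerStep_directed (S.frame f) (x := S.place i f b a) (j := f) (k := S.l) he hs0
      hf.symm (hsee _ hb_mem (hdb ▸ hs)) (by rwa [S.place_active i hf, S.place_leader])
      fun k hkf s' hs' hk => by
        rw [S.place_active i hf] at hk
        by_cases hkl : k = S.l
        · rw [hkl, S.place_leader] at hk
          rw [← hdb, hk, hdist s' hs'.le]
        -- A follower nearer on the ray would stand on the segment from `a` to `b`, which is clear.
        · by_contra! hlt
          have := hne b _ (hmem s' hs'.le hlt.le) k hkf hkl
          rw [hk, dist_self] at this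
          linarith
    rwa [S.place_active i hf, S.place_leader] at this
  -- The leader now stands at `b + u`, so `b` is free and `f` moves.
  have h₃ : S.exec (t + 3) = S.config i f (b + u) b m₃ .idle := by
    refine exec_succ_config h₂ hi (hc' _ (right_mem_segment ℝ _ _)) (fun _ => hc a ha_mem) hm₂
      (fun _ _ => hl₂ _ _) fun _ => ?_
    have := followerStep_instructed (S.frame f) (x := S.place i f (b + u) a) (j := f) (dest := b)
      fun k hkf => by
        by_cases hkl : k = S.l
        · rw [hkl, S.place_leader]
          exact hd b hb_mem
        · rw [dist_comm]
          exact (hne _ b hb_mem k hkf hkl).le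
    rwa [S.place_active i hf] at this
  refine ⟨h₃, ?_, ?_, ?_⟩
  · refine good_of_leader_moves h₀ h₁ hi hr₀ (fun z hz => hc z (hsub hz)) (fun _ => hc a ha_mem)
      fun _ z hz => ?_
    rw [hae, hb] at hz
    obtain ⟨s', h1, -, rfl⟩ := exists_of_mem_segment_ray hs hz
    rwa [hdist s' (by linarith)]
  · exact good_of_leader_moves h₁ h₂ hi hr₁ hc' (fun _ => hc a ha_mem) fun _ => hd'
  · refine good_of_active_moves h₀ h₁ h₂ h₃ hi hf hr₂ (hc' _ (right_mem_segment ℝ _ _)) hc hd hda ?_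
    rw [hb, add_sub_cancel_left, add_sub_cancel_left, ← real_smul]
    exact SameRay.sameRay_nonneg_smul_right e hs0.le


/-! ### Fetching one follower -/

variable (S)

/-- The memory of the leader after departure. -/
def memory (σ : Stage) (i : ℕ) (aim : ℂ) : LeaderMemory where
  stage := σ
  turn := S.turn
  count := n
  index := i
  centre := S.frame S.l S.c
  corner := S.corner
  aim := aim

theorem departed_memory {σ : Stage} (h : σ ≠ .depart) (i : ℕ) (aim : ℂ) :
    S.Departed (S.memory σ i aim) := ⟨h, rfl⟩

theorem inRange_memory (σ : Stage) {i : ℕ} (hi : i ≤ n) (aim : ℂ) :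
    S.InRange (S.memory σ i aim) := ⟨le_rfl, hi⟩

variable {S}

theorem config_succ {f : Fin n} (hf : f ≠ S.l) (L a : ℂ) (m : LeaderMemory) :
    S.config (S.rank f) f L (S.slot (S.rank f)) m .idle =
      S.config (S.rank f + 1) S.l L a m .idle := by
  simp [config, ← S.place_succ hf L a]

theorem config_rank (f : Fin n) (L a : ℂ) (m : LeaderMemory) :
    S.config (S.rank f) f L (S.start f) m .idle = S.config (S.rank f) S.l L a m .idle := by
  simp [config, S.place_rank f L a]

/-- The leader places the robot `f`. -/
theorem fetch {t : ℕ} {f : Fin n} {L : ℂ} (hf : f ≠ S.l) (hk : S.rank f < S.P.points.card)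
    (h : S.exec t = S.config (S.rank f) f L (S.start f)
      (S.memory .beside (S.rank f) (S.start f)) .idle)
    (hL : S.corner.re - 99 < L.re) (hL' : L.re < (S.start f).re - 1 ∨
      L.re = (S.start f).re - 1 ∧ (S.start f).im ≤ L.im) (hLr : 1 < dist L (S.start f)) :
    S.exec (t + 10) = S.config (S.rank f) f (S.slot (S.rank f) + -(2 * I)) (S.slot (S.rank f))
      (S.memory .next (S.rank f + 1) (S.start f)) .idle ∧
    ∀ s, t ≤ s → s < t + 10 → S.Good s := by
  set i := S.rank f with hi
  set r := S.start f with hr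
  set p := S.slot i with hp
  set q : ℂ := ⟨S.corridor, r.im⟩ with hq
  set q' : ℂ := ⟨S.corridor, p.im⟩ with hq'
  have hin : i < n - 1 := S.rank_lt hf
  have hcor : S.corridor = S.corner.re - 90 := rfl
  have hrre : S.corner.re ≤ r.re := S.corner_re_le f
  have hrim : r.im ≤ S.corner.im := S.le_corner_im f
  have hpre : p.re ≤ S.corner.re - 100 := (S.slot_bounds hk).1
  have hpim : S.corner.im + 100 ≤ p.im := (S.slot_bounds hk).2
  have clear_corridor (z : ℂ) (h1 : S.corner.re - 99 < z.re) (h2 : z.re < S.corner.re - 1) :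
      S.Clear i f z :=
    S.clear_of (S.slots_clear_of_re hk.le h1) fun j _ _ _ => S.starts_clear_of_re h2 j
  have clear_start (z : ℂ) (h1 : S.corner.re - 99 < z.re) (h2 : z.im = r.im) (h3 : z.re ≤ r.re) :
      S.Clear i f z :=
    S.clear_of (S.slots_clear_of_re hk.le h1) fun j hj hjf h =>
      S.starts_clear_of_left hj hjf h h2 h3
  have clear_slot (z : ℂ) (h1 : p.re ≤ z.re) (h2 : z.im ≤ p.im) (h3 : p.im - 2 ≤ z.im) :
      S.Clear i f z :=
    S.clear_of (S.slots_clear_of_slot hk h1 h2 h3) fun j _ _ _ =>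
      S.starts_clear_of_im (by linarith) j
  have clear_beside (z : ℂ) (hz : z ∈ segment ℝ L (r + -1)) :
      S.Clear i f z ∧ 1 ≤ dist z r := by
    have h1 : S.corner.re - 99 < z.re := by
      refine lt_of_lt_of_le (lt_min hL (show S.corner.re - 99 < S.corner.re - 1 by linarith))
        (le_re_of_mem_segment (min_le_left _ _) ((min_le_right _ _).trans ?_) hz)
      simp only [add_re, neg_re, one_re]
      linarith
    -- The region described is convex and contains both `L` and the place directly to the left of
    -- `r`.
    have h2 : z.re < r.re - 1 ∨ z.re = r.re - 1 ∧ r.im ≤ z.im := by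
      obtain ⟨α, β, hα, hβ, hαβ, rfl⟩ := hz
      obtain rfl : β = 1 - α := by linarith
      simp only [add_re, add_im, real_smul, re_ofReal_mul, im_ofReal_mul, neg_re, neg_im, one_re,
        one_im]
      rcases hα.eq_or_lt with rfl | hα
      · right
        constructor <;> linarith
      · rcases hL' with hL' | ⟨hL', hL''⟩
        · left
          nlinarith
        · right
          rw [hL']
          constructor <;> nlinarith
    refine ⟨S.clear_of (S.slots_clear_of_re hk.le h1) fun j hj hjf h =>
      S.starts_clear_of_beside hj hjf h h2, ?_⟩
    have := re_sub_le_dist r z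
    rw [dist_comm] at this
    rcases h2 with h2 | ⟨h2, -⟩ <;> linarith
  have hd (σ : Stage) (j : ℕ) (hσ : σ ≠ .depart := by simp) := S.departed_memory hσ j r
  have hg (σ : Stage) := S.inRange_memory σ (show i ≤ n by omega) r
  have h1 : S.exec (t + 1) = S.config i f (r + -1) r (S.memory .leadLeft i r) .idle :=
    exec_succ_config h hk.le (clear_beside L (left_mem_segment _ _ _)).1
      (fun _ => clear_start r (by linarith) rfl le_rfl) (hd _ _)
      (fun _ _ => by simp [leaderMove, memory, sub_eq_add_neg])
      fun _ => by
        have := followerStep_untouched (S.frame f) (x := S.place i f L r) (j := f) fun k hkf => by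
          rw [S.place_active i hf]
          by_cases hkl : k = S.l
          · rw [hkl, S.place_leader]
            exact hLr.ne'
          · rw [S.place_other i hkl hkf, dist_comm]
            exact (clear_start r (by linarith) rfl le_rfl k hkl hkf).ne'
        rwa [S.place_active i hf] at this
  have g0 : S.Good t := good_of_leader_moves h h1 hk.le (hg _) (fun z hz => (clear_beside z hz).1)
    (fun _ => clear_start r (by linarith) rfl le_rfl) fun _ z hz => (clear_beside z hz).2
  -- The three legs have directions `-1`, `I`, `-1`. In the first two, `u` is the direction of the
  -- next leg; in the third it has length 2, so that touch is lost.
  obtain ⟨h4, g1, g2, g3⟩ := leg (b := q) (u := I) (s := r.re - S.corridor)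
    (m₁ := S.memory .signalUp i r) (m₂ := S.memory .waitLeft i r) (m₃ := S.memory .leadUp i r)
    h1 hk.le hf (by simp) (by linarith)
    (by apply Complex.ext <;> simp [hq]) (hd _ _) (hd _ _) (hd _ _) (hg _) (hg _) (hg _)
    (fun C seen => by simp [leaderMove, memory, hq, hcor])
    (fun C seen => by simp [leaderMove, memory])
    (fun C seen => by simp [leaderMove, memory])
    (fun z hz => by
      have a1 := le_re_of_mem_segment (c := S.corridor) (by linarith) (by simp [hq]) hz
      have a2 := re_le_of_mem_segment (c := r.re) le_rfl (by simp [hq]; linarith) hz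
      have a3 := le_im_of_mem_segment (c := r.im) le_rfl (by simp [hq]) hz
      have a4 := im_le_of_mem_segment (c := r.im) le_rfl (by simp [hq]) hz
      exact clear_start z (by linarith) (le_antisymm a4 a3) a2)
    (fun z hz => by
      have a1 := le_re_of_mem_segment (c := S.corridor) (by simp [hq]) (by simp [hq]) hz
      have a2 := re_le_of_mem_segment (c := S.corridor) (by simp [hq]) (by simp [hq]) hz
      exact clear_corridor z (by linarith) (by linarith))
    (fun z hz => by
      have a4 := im_le_of_mem_segment (c := r.im) le_rfl (by simp [hq]) hz
      have := im_sub_le_dist (q + I) z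
      simp [hq] at this ⊢
      linarith)
    (fun z hz => by
      have a2 := re_le_of_mem_segment (c := S.corridor) (by simp [hq]) (by simp [hq]) hz
      have := re_sub_le_dist r z
      rw [dist_comm] at this
      linarith)
  obtain ⟨h7, g4, g5, g6⟩ := leg (b := q') (u := -1) (s := p.im - r.im)
    (m₁ := S.memory .signalLeft i r) (m₂ := S.memory .waitUp i r) (m₃ := S.memory .leadSlot i r)
    h4 hk.le hf (by simp) (by linarith)
    (by apply Complex.ext <;> simp [hq, hq']) (hd _ _) (hd _ _) (hd _ _) (hg _) (hg _) (hg _)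
    (fun C seen => by simp [leaderMove, memory, hq', hcor, hp, slot])
    (fun C seen => by simp [leaderMove, memory, sub_eq_add_neg])
    (fun C seen => by simp [leaderMove, memory])
    (fun z hz => by
      have a1 := le_re_of_mem_segment (c := S.corridor) (by simp [hq]) (by simp [hq']) hz
      have a2 := re_le_of_mem_segment (c := S.corridor) (by simp [hq]) (by simp [hq']) hz
      exact clear_corridor z (by linarith) (by linarith))
    (fun z hz => by
      have a1 := le_re_of_mem_segment (c := S.corridor - 1) (by simp [hq'])
        (by simp [hq', sub_eq_add_neg]) hz
      have a2 := re_le_of_mem_segment (c := S.corridor) (by simp [hq']) (by simp [hq']) hz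
      exact clear_corridor z (by linarith) (by linarith))
    (fun z hz => by
      have a1 := le_re_of_mem_segment (c := S.corridor) (by simp [hq]) (by simp [hq']) hz
      have := re_sub_le_dist z (q' + -1)
      rw [dist_comm] at this
      simp [hq'] at this ⊢
      linarith)
    (fun z hz => by
      have a1 := le_im_of_mem_segment (c := p.im) (by simp [hq']) (by simp [hq']) hz
      have := im_sub_le_dist z q
      simp [hq] at this ⊢
      linarith)
  obtain ⟨h10, g7, g8, g9⟩ := leg (b := p) (u := -(2 * I)) (s := S.corridor - p.re)
    (m₁ := S.memory .stepAway i r) (m₂ := S.memory .waitSlot i r)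
    (m₃ := S.memory .next (i + 1) r)
    h7 hk.le hf (by simp) (by linarith)
    (by apply Complex.ext <;> simp [hq']) (hd _ _) (hd _ _) (hd _ _) (hg _) (hg _) (hg _)
    (fun C seen => by simp [leaderMove, memory, hp, slot])
    (fun C seen => by simp [leaderMove, memory, sub_eq_add_neg])
    (fun C seen => by simp [leaderMove, memory])
    (fun z hz => by
      have a1 := le_re_of_mem_segment (c := p.re) (by simp [hq']; linarith) le_rfl hz
      have a3 := le_im_of_mem_segment (c := p.im) (by simp [hq']) le_rfl hz
      have a4 := im_le_of_mem_segment (c := p.im) (by simp [hq']) le_rfl hz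
      exact clear_slot z a1 a4 (by linarith))
    (fun z hz => by
      have a1 := le_re_of_mem_segment (c := p.re) le_rfl (by simp) hz
      have a3 := le_im_of_mem_segment (c := p.im - 2) (by simp) (by simp [sub_eq_add_neg]) hz
      have a4 := im_le_of_mem_segment (c := p.im) le_rfl (by simp) hz
      exact clear_slot z a1 a4 a3)
    (fun z hz => by
      have a3 := le_im_of_mem_segment (c := p.im) (by simp [hq']) le_rfl hz
      have := im_sub_le_dist z (p + -(2 * I))
      rw [dist_comm] at this
      simp at this ⊢
      linarith)
    (fun z hz => by
      have a2 := re_le_of_mem_segment (c := p.re) le_rfl (by simp) hz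
      have := re_sub_le_dist q' z
      rw [dist_comm] at this
      simp [hq'] at this ⊢
      linarith)
  refine ⟨h10, fun s hs hs' => ?_⟩
  obtain ⟨d, rfl⟩ := Nat.exists_eq_add_of_le hs
  -- One round of approach and three legs of three rounds.
  have hd10 : d < 10 := by omega
  interval_cases d <;> assumption


/-! ### Between two fetches, and the end of the phase -/

theorem of_leader_ne {p : Prop} (h : S.l ≠ S.l) : p := absurd rfl h

/-- Unlike in `slots_clear_of_slot`, slot `i` itself is now occupied; the leader passes 2 below it.
-/
theorem clear_after {i : ℕ} (hk : i < S.P.points.card) {z : ℂ}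
    (hre : (S.slot i).re ≤ z.re) (him : z.im = (S.slot i).im - 2) : S.Clear (i + 1) S.l z := by
  have := (S.slot_bounds hk).2
  refine S.clear_of (fun m hm => ?_) fun j _ _ _ => S.starts_clear_of_im (by linarith) j
  rcases Nat.lt_succ_iff_lt_or_eq.1 hm with hm | rfl
  · exact S.slots_clear_of_slot hk hre (by linarith) him.ge m hm
  · have := im_sub_le_dist (S.slot m) z
    rw [dist_comm] at this
    linarith

/-- The leader, standing below the slot that was filled last, sees the robot to be fetched next. -/
theorem sees_next {i : ℕ} (hk : i < S.P.points.card) {f : Fin n} (hf : f ≠ S.l)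
    (hr : S.rank f = i + 1) :
    Sees (S.place (i + 1) S.l (S.slot i + -(2 * I)) 0) S.l f := by
  set p := S.slot i with hp
  set r := S.start f with hrs
  have hpf : S.place (i + 1) S.l (p + -(2 * I)) 0 f = r := by
    rw [S.place_other _ hf hf]
    simp [rest, hr, hrs]
  have hpre := (S.slot_bounds hk).1
  have hrre := S.corner_re_le f
  rw [← hp] at hpre
  rw [← hrs] at hrre
  -- The line of sight joins the rightmost point of the leader to the leftmost point of `f`. All
  -- centres of third robots have abscissa at most `p.re` or at least `r.re`, so their disks could
  -- meet it only at an end.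
  refine ⟨p + -(2 * I) + (1 / 2 : ℝ), ?_, r - (1 / 2 : ℝ), ?_, fun k hkl hkf =>
    Set.disjoint_left.2 fun z hz hzk => ?_⟩
  · rw [S.place_leader, Metric.mem_sphere, dist_eq_norm, add_sub_cancel_left, norm_real]
    norm_num
  · rw [hpf, Metric.mem_sphere, dist_eq_norm, sub_sub_cancel_left, norm_neg, norm_real]
    norm_num
  rw [S.place_other _ hkl hkl, Metric.mem_closedBall] at hzk
  have hsq := sq_le_sq' (by linarith [dist_nonneg (x := z) (y := S.rest (i + 1) k)]) hzk
  rw [dist_sq_eq] at hsq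
  have hre := (re_sub_le_dist z (S.rest (i + 1) k)).trans hzk
  have hre' := (re_sub_le_dist (S.rest (i + 1) k) z).trans (dist_comm _ z ▸ hzk)
  obtain ⟨α, β, hα, hβ, hαβ, hz⟩ := hz
  obtain rfl : α = 1 - β := by linarith
  have hzre : z.re = p.re + 1 / 2 + β * (r.re - p.re - 1) := by
    rw [← hz]
    simp
    ring
  have hzim : z.im = p.im - 2 + β * (r.im - p.im + 2) := by
    rw [← hz]
    simp
    ring
  unfold rest at hsq hre hre'
  split_ifs at hsq hre hre' with hlt
  · have hlt' := S.leftTop_slot (Nat.lt_succ_iff.1 hlt) hk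
    have h1 := re_le_of_leftTop hlt'
    rw [← hp] at h1 hlt'
    -- At the left end the centre would have to be that of the leader, but a placed robot with
    -- abscissa `p.re` is not below `p`.
    have hβ0 : β = 0 := by nlinarith
    subst hβ0
    rcases hlt' with h2 | ⟨h2, h3⟩
    · linarith
    · nlinarith
  · have hlt' := S.leftTop_start (j := f) hkl (by omega)
    have h1 := re_le_of_leftTop hlt'
    rw [← hrs] at h1 hlt'
    -- At the right end the centre would have to be `r` itself.
    have hβ1 : β = 1 := by nlinarith
    subst hβ1
    have h2 : (S.start k).re = r.re := by linarith
    have h3 : (S.start k).im = r.im := by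
      have : (z.im - (S.start k).im) ^ 2 ≤ 0 := by nlinarith
      have := pow_eq_zero_iff (two_ne_zero) |>.1 (this.antisymm (sq_nonneg _))
      linarith
    exact hkf (S.start_injective (Complex.ext h2 h3))

theorem segment_after {i : ℕ} (hk : i < S.P.points.card) {x : ℝ} (hx : (S.slot i).re ≤ x) :
    ∀ z ∈ segment ℝ (S.slot i + -(2 * I)) ⟨x, (S.slot i).im - 2⟩, S.Clear (i + 1) S.l z := by
  intro z hz
  have a1 := le_re_of_mem_segment (c := (S.slot i).re) (by simp) (by simpa using hx) hz
  have a3 := le_im_of_mem_segment (c := (S.slot i).im - 2) (by simp [sub_eq_add_neg]) le_rfl hz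
  have a4 := im_le_of_mem_segment (c := (S.slot i).im - 2) (by simp [sub_eq_add_neg]) le_rfl hz
  exact clear_after hk a1 (le_antisymm a4 a3)

/-- The leader goes to the next robot. -/
theorem approach {t i : ℕ} {f : Fin n} {aim : ℂ} (hk : i + 1 < S.P.points.card) (hf : f ≠ S.l)
    (hr : S.rank f = i + 1)
    (h : S.exec t = S.config (i + 1) S.l (S.slot i + -(2 * I)) 0 (S.memory .next (i + 1) aim) .idle) :
    S.Good t ∧ S.exec (t + 1) = S.config (i + 1) S.l ⟨(S.start f).re - 1, (S.slot i).im - 2⟩ 0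
      (S.memory .beside (i + 1) (S.start f)) .idle := by
  have hin := S.rank_lt hf
  have hk' : i < S.P.points.card := by omega
  have hpre := (S.slot_bounds hk').1
  have hrre := S.corner_re_le f
  have hclear := segment_after hk' (x := (S.start f).re - 1) (by linarith)
  have h' : S.exec (t + 1) = S.config (i + 1) S.l ⟨(S.start f).re - 1, (S.slot i).im - 2⟩ 0
      (S.memory .beside (i + 1) (S.start f)) .idle := by
    refine exec_succ_config h hk.le (hclear _ (left_mem_segment _ _ _)) of_leader_ne
      (S.departed_memory (by simp) _ _) (fun seen hseen => ?_) of_leader_ne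
    subst hseen
    rw [leaderMove_next (f := S.start f) rfl ⟨hk, show i + 1 + 1 < n by omega⟩
      (mem_visible.2 ⟨f, ⟨hf, sees_next hk' hf hr⟩, ?_⟩) hrre fun z hz hzre => ?_]
    · simp [memory, sub_eq_add_neg]
    · rw [S.place_other _ hf hf]
      simp [rest, hr]
    · replace hzre : S.corner.re ≤ z.re := hzre
      obtain ⟨j, ⟨hj, -⟩, rfl⟩ := mem_visible.1 hz
      rw [S.place_other _ hj hj] at hzre ⊢
      unfold rest at hzre ⊢
      split_ifs at hzre ⊢ with hlt
      · have := (S.slot_bounds (show S.rank j < S.P.points.card by omega)).1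
        linarith
      · exact S.leftTop_start hj (by omega)
  refine ⟨good_of_leader_moves h h' hk.le (S.inRange_memory _ (by omega) _) hclear
    of_leader_ne of_leader_ne, h'⟩

/-- All robots that are needed have been placed, and the leader goes back to the corridor. -/
theorem retreat {t i : ℕ} {aim : ℂ} (hk : i < S.P.points.card) (hin : i < n - 1)
    (hlast : ¬ (i + 1 < S.P.points.card ∧ i + 1 + 1 < n))
    (h : S.exec t = S.config (i + 1) S.l (S.slot i + -(2 * I)) 0 (S.memory .next (i + 1) aim) .idle) :
    S.Good t ∧ S.exec (t + 1) = S.config (i + 1) S.l ⟨S.corridor, (S.slot i).im - 2⟩ 0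
      (S.memory (if S.P.points.card = n then .fillUp else .done) (i + 1) aim) .idle := by
  have hpre := (S.slot_bounds hk).1
  have hclear := segment_after hk (x := S.corridor) (by unfold corridor; linarith)
  have h' : S.exec (t + 1) = S.config (i + 1) S.l ⟨S.corridor, (S.slot i).im - 2⟩ 0
      (S.memory (if S.P.points.card = n then .fillUp else .done) (i + 1) aim) .idle := by
    refine exec_succ_config h hk (hclear _ (left_mem_segment _ _ _)) of_leader_ne
      (S.departed_memory (by simp) _ _) (fun seen hseen => ?_) of_leader_ne
    simp only [leaderMove, memory]
    by_cases hkn : S.P.points.card = n <;> simp [hlast, hkn, sub_eq_add_neg, corridor]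
    omega
  exact ⟨good_of_leader_moves h h' hk (S.inRange_memory _ (by omega) _) hclear
    of_leader_ne of_leader_ne, h'⟩

theorem exec_done {t m : ℕ} {L aim : ℂ} (hm : m ≤ S.P.points.card) (hL : S.Clear m S.l L)
    (h : S.exec t = S.config m S.l L 0 (S.memory .done m aim) .idle) :
    ∀ s ≥ t, S.exec s = S.config m S.l L 0 (S.memory .done m aim) .idle := by
  intro s hs
  induction s, hs using Nat.le_induction with
  | base => exact h
  | succ s _ ih =>
    exact exec_succ_config ih hm hL of_leader_ne (S.departed_memory (by simp) _ _)
      (fun seen _ => by simp [leaderMove, memory]) of_leader_ne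

theorem good_done {t m : ℕ} {L aim : ℂ} (hm : m ≤ S.P.points.card) (hL : S.Clear m S.l L)
    (h : S.exec t = S.config m S.l L 0 (S.memory .done m aim) .idle) :
    ∀ s ≥ t, S.Good s := by
  intro s hs
  have hmn : m ≤ n := hm.trans S.card_le
  refine good_of_leader_moves (exec_done hm hL h s hs) (exec_done hm hL h (s + 1) (by omega)) hm
    (S.inRange_memory _ hmn _) (fun z hz => ?_) of_leader_ne of_leader_ne
  rw [segment_same, Set.mem_singleton_iff] at hz
  rwa [hz]

/-- The end of the phase: the leader takes the last slot if it is needed. -/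
theorem finish {t m : ℕ} {L aim : ℂ} (hm : m ≤ S.P.points.card) (hL : S.Clear m S.l L)
    (hfill : S.P.points.card = n → m = n - 1 ∧
      ∀ z ∈ segment ℝ L ⟨S.corridor, (S.slot (n - 1)).im⟩, S.Clear m S.l z)
    (h : S.exec t = S.config m S.l L 0
      (S.memory (if S.P.points.card = n then .fillUp else .done) m aim) .idle) :
    ∃ t' ≤ t + 2, ∃ L', S.exec t' = S.config m S.l L' 0 (S.memory .done m aim) .idle ∧
      S.Clear m S.l L' ∧ (S.P.points.card = n → L' = S.slot (n - 1)) ∧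
      ∀ s, t ≤ s → s < t' → S.Good s := by
  have hmn : m ≤ n := hm.trans S.card_le
  by_cases hkn : S.P.points.card = n
  swap
  · rw [if_neg hkn] at h
    exact ⟨t, by omega, L, h, hL, fun h => absurd h hkn, fun s h1 h2 => by omega⟩
  rw [if_pos hkn] at h
  obtain ⟨hmn', hclear⟩ := hfill hkn
  have hn := S.n_pos
  have hlast : n - 1 < S.P.points.card := by omega
  have hpre := (S.slot_bounds hlast).1
  have h1 : S.exec (t + 1) = S.config m S.l ⟨S.corridor, (S.slot (n - 1)).im⟩ 0
      (S.memory .fillSlot m aim) .idle :=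
    exec_succ_config h hm hL of_leader_ne (S.departed_memory (by simp) _ _)
      (fun seen _ => by simp [leaderMove, memory, hkn, corridor, slot]) of_leader_ne
  have hclear' : ∀ z ∈ segment ℝ ⟨S.corridor, (S.slot (n - 1)).im⟩ (S.slot (n - 1)),
      S.Clear m S.l z := by
    intro z hz
    have a1 := le_re_of_mem_segment (c := (S.slot (n - 1)).re) (by simp [corridor]; linarith)
      le_rfl hz
    have a3 := le_im_of_mem_segment (c := (S.slot (n - 1)).im) (by simp) le_rfl hz
    have a4 := im_le_of_mem_segment (c := (S.slot (n - 1)).im) (by simp) le_rfl hz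
    -- All `n - 1` followers have been placed, so no waiting robot remains.
    refine S.clear_of ?_ fun j hj _ hmj => ?_
    · rw [hmn']
      exact S.slots_clear_of_slot hlast a1 a4 (by linarith)
    · have := S.rank_lt hj
      omega
  have h2 : S.exec (t + 2) = S.config m S.l (S.slot (n - 1)) 0 (S.memory .done m aim) .idle :=
    exec_succ_config h1 hm (hclear' _ (left_mem_segment _ _ _)) of_leader_ne
      (S.departed_memory (by simp) _ _)
      (fun seen _ => by simp [leaderMove, memory, hkn, slot]) of_leader_ne
  have g0 := good_of_leader_moves h h1 hm (S.inRange_memory _ hmn _) hclear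
    of_leader_ne of_leader_ne
  have g1 := good_of_leader_moves h1 h2 hm (S.inRange_memory _ hmn _) hclear'
    of_leader_ne of_leader_ne
  refine ⟨t + 2, le_rfl, _, h2, hclear' _ (right_mem_segment _ _ _), fun _ => rfl,
    fun s hs hs' => ?_⟩
  obtain rfl | rfl : s = t ∨ s = t + 1 := by omega
  · exact g0
  · exact g1


variable (S)

/-! ### The departure of the leader -/

/-- A second robot, strictly closer to `S.c`, shows that the leader is not at `S.c`. -/
theorem vector_spec (hn : n ≠ 1) :
    (S.start S.l - S.c).re < 0 ∧ 0 ≤ (S.start S.l - S.c).im := by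
  have hn0 := S.n_pos
  obtain ⟨f, hf, -⟩ := S.exists_rank (i := 0) (by omega)
  have hne : S.frame S.l (S.start S.l) - S.frame S.l S.c ≠ 0 := by
    refine sub_ne_zero.2 fun h => ?_
    have h1 := S.elected.circle f hf
    rw [(S.frame S.l).injective h, dist_self] at h1
    exact absurd dist_nonneg (not_le.2 h1)
  have := quarterTurns_spec hne
  rwa [S.turn_eq, mul_sub, S.frame_leader, S.frame_leader] at this

/-- The leader departs to this place. -/
def departure : ℂ :=
  S.start S.l + (((S.start S.l).re - S.corner.re + 2) / (-(S.start S.l - S.c).re) : ℝ) *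
    (S.start S.l - S.c)

/-- The robot that is fetched first. -/
def first : ℂ := (ordered S.followers).headD 0

theorem departure_re (hn : n ≠ 1) : S.departure.re = S.corner.re - 2 := by
  have h := (S.vector_spec hn).1
  simp only [departure, add_re, re_ofReal_mul]
  have h' : (S.start S.l - S.c).re ≠ 0 := h.ne
  field_simp
  ring

/-- On its way away from `S.c` the leader does not come closer to the others. -/
theorem clear_departure : ∀ z ∈ segment ℝ (S.start S.l) S.departure, S.Clear 0 S.l z := by
  intro z hz j hj _
  have hn : n ≠ 1 := by
    rintro rfl
    exact hj (Subsingleton.elim _ _)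
  have hu := (S.vector_spec hn).1
  have hq : 0 ≤ ((S.start S.l).re - S.corner.re + 2) / (-(S.start S.l - S.c).re) :=
    div_nonneg (by linarith [S.corner_re_le S.l]) (by linarith)
  rw [departure] at hz
  nth_rewrite 1 [show S.start S.l = S.start S.l + (0 : ℝ) * (S.start S.l - S.c) by simp] at hz
  obtain ⟨s, hs, -, rfl⟩ := exists_of_mem_segment_ray hq hz
  have h1 := sq_lt_of_lt_dist (by norm_num) (S.elected.apart S.l j hj.symm)
  have h2 : dist (S.start j) S.c ^ 2 < dist (S.start S.l) S.c ^ 2 := by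
    gcongr
    exact S.elected.circle j hj
  rw [dist_sq_eq, dist_sq_eq] at h2
  have h3 : S.rest 0 j = S.start j := by simp [rest]
  rw [h3]
  refine lt_dist_of_sq (h1.trans_le ?_)
  simp only [add_re, add_im, re_ofReal_mul, im_ofReal_mul, sub_re, sub_im]
  set x := (S.start S.l).re
  set y := (S.start S.l).im
  set x' := (S.start j).re
  set y' := (S.start j).im
  set a := S.c.re
  set b := S.c.im
  -- Twice this inner product is `|l - c|² - |j - c|² + |l - j|²`. Its sign makes the distance to
  -- `j` nondecreasing along the ray.
  have h4 : 0 ≤ (x - a) * (x - x') + (y - b) * (y - y') := by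
    nlinarith [sq_nonneg (x - x'), sq_nonneg (y - y')]
  nlinarith [mul_nonneg hs h4, mul_nonneg hs hs, sq_nonneg (s * (x - a)), sq_nonneg (s * (y - b))]

theorem visible_start : visible S.start S.l = S.followers := by
  ext z
  rw [mem_visible, mem_followers]
  exact ⟨fun ⟨j, ⟨hj, _⟩, h⟩ => ⟨j, hj, h⟩,
    fun ⟨j, hj, h⟩ => ⟨j, ⟨hj, S.elected.visible _ _ hj.symm⟩, h⟩⟩

theorem followers_eq_empty_iff : S.followers = ∅ ↔ n = 1 := by
  rw [← Finset.card_eq_zero, card_followers]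
  have := S.n_pos
  omega

theorem start_notMem_followers : S.start S.l ∉ S.followers := fun h => by
  obtain ⟨j, hj, h⟩ := S.mem_followers.1 h
  exact hj (S.start_injective h)

theorem place_start (a : ℂ) : S.place 0 S.l (S.start S.l) a = S.start := by
  funext j
  by_cases hj : j = S.l <;> simp [place, rest, hj]

/-- The memory of the leader at the start. -/
def memory₀ : LeaderMemory where
  stage := .depart
  turn := 0
  count := 0
  index := 0
  centre := S.frame S.l S.c
  corner := 0
  aim := 0

theorem exec_zero : S.exec 0 = S.config 0 S.l (S.start S.l) 0 S.memory₀ .idle := by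
  simp only [exec, execution, config, Function.iterate_zero, id, initial, place_start, ite_self,
    memory₀]

theorem leaderMove_depart (m : LeaderMemory) (hm : m.stage = .depart) :
    leaderMove S.P m S.c (S.start S.l) S.followers =
      ({ m with
          stage := if n = 1 then .fillUp else .beside
          count := n
          index := 0
          corner := S.corner
          aim := S.first }, S.departure) := by
  have hcard : (insert (S.start S.l) S.followers).card = n := by
    rw [Finset.card_insert_of_notMem S.start_notMem_followers, card_followers]
    have := S.n_pos
    omega
  have h1 : (if S.followers = ∅ then Stage.fillUp else Stage.beside) =
      if n = 1 then Stage.fillUp else Stage.beside := by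
    simp only [S.followers_eq_empty_iff]
  simp only [leaderMove, hm]
  congr!

theorem leaderStep_depart :
    leaderStep S.P S.memory₀ (S.frame S.l (S.start S.l)) (snapshot (S.frame S.l) S.start S.l) =
      (S.memory (if n = 1 then .fillUp else .beside) 0 S.first, S.frame S.l S.departure) := by
  have ho : S.memory₀.orient (S.frame S.l (S.start S.l)) = { S.memory₀ with turn := S.turn } := by
    simp [LeaderMemory.orient, memory₀, S.turn_eq]
  have hc : S.memory₀.centre = S.frame S.l S.c := rfl
  simp only [leaderStep, ho, hc, S.frame_leader, S.neg_I_pow_mul]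
  rw [S.image_snapshot, visible_start, S.leaderMove_depart _ rfl]
  rfl

/-- The departure is computed separately because the leader sets its turn in this round, which
`Departed` excludes. -/
theorem exec_one : S.exec 1 = S.config 0 S.l S.departure 0
    (S.memory (if n = 1 then .fillUp else .beside) 0 S.first) .idle := by
  have hz := S.exec_zero
  have key (j) : compute S.P S.frame (S.exec 0) j =
      ((S.config 0 S.l S.departure 0
        (S.memory (if n = 1 then .fillUp else .beside) 0 S.first) .idle).mem j,
      S.frame j (S.place 0 S.l S.departure 0 j)) := by
    rw [hz]
    by_cases hj : j = S.l
    · subst hj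
      simp only [compute, config, robotStep, if_true, S.place_start, S.leaderStep_depart,
        place_leader]
    · have hx := followerStep_untouched (S.frame j) (x := S.start) (j := j)
        fun k hk => (S.elected.apart k j hk).ne'
      simp only [compute, config, robotStep, hj, if_false, S.place_start, ite_self, hx]
      simp [place, rest, hj]
  rw [← zero_add 1, exec_succ]
  simp only [round, key]
  simp [config]

theorem good_zero : S.Good 0 :=
  good_of_leader_moves S.exec_zero S.exec_one (Nat.zero_le _)
    ⟨Nat.zero_le _, Nat.zero_le _⟩ S.clear_departure of_leader_ne of_leader_ne

/-! ### The course of the phase -/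

theorem first_eq {f : Fin n} (hf : f ≠ S.l) (hr : S.rank f = 0) : S.first = S.start f :=
  ordered_headD_eq (S.start_mem_followers hf) (fun z hz => by
    obtain ⟨j, hj, rfl⟩ := S.mem_followers.1 hz
    exact S.leftTop_start hj (hr ▸ Nat.zero_le _)) 0

theorem card_pos : 0 < S.P.points.card := Finset.card_pos.2 S.P.nonempty

/-- The invariant of the main loop: one round of departure, then 10 rounds of `fetch` and one of
`approach` per follower. The point `L` is specified only by what `fetch` requires, since the first
follower is approached from the left and the later ones from above. -/
theorem exists_fetch (i : ℕ) (hi : i < min S.P.points.card (n - 1)) :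
    ∃ f L, f ≠ S.l ∧ S.rank f = i ∧ S.exec (1 + 11 * i) = S.config (S.rank f) f L (S.start f)
        (S.memory .beside (S.rank f) (S.start f)) .idle ∧
      S.corner.re - 99 < L.re ∧ (L.re < (S.start f).re - 1 ∨
        L.re = (S.start f).re - 1 ∧ (S.start f).im ≤ L.im) ∧ 1 < dist L (S.start f) ∧
      ∀ s < 1 + 11 * i, S.Good s := by
  induction i with
  | zero =>
    obtain ⟨f, hf, hr⟩ := S.exists_rank (i := 0) (by omega)
    have hn : n ≠ 1 := by omega
    have hre := S.departure_re hn
    have hfre := S.corner_re_le f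
    refine ⟨f, S.departure, hf, hr, ?_, by linarith, Or.inl (by linarith), ?_, fun s hs => ?_⟩
    · rw [config_rank f _ 0, hr, S.exec_one, if_neg hn, S.first_eq hf hr]
    · have := re_sub_le_dist (S.start f) S.departure
      rw [dist_comm] at this
      linarith
    · obtain rfl : s = 0 := by omega
      exact S.good_zero
  | succ i ih =>
    obtain ⟨f, L, hf, rfl, h, hL, hL', hLr, hg⟩ := ih (by omega)
    obtain ⟨f', hf', hr'⟩ := S.exists_rank (i := S.rank f + 1) (by omega)
    have hk : S.rank f + 1 < S.P.points.card := by omega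
    obtain ⟨h1, hg1⟩ := fetch hf (by omega) h hL hL' hLr
    rw [config_succ hf _ 0] at h1
    obtain ⟨g2, h2⟩ := approach hk hf' hr' h1
    have him := (S.slot_bounds (show S.rank f < S.P.points.card by omega)).2
    have him' := S.le_corner_im f'
    have hre' := S.corner_re_le f'
    refine ⟨f', ⟨(S.start f').re - 1, (S.slot (S.rank f)).im - 2⟩, hf', hr', ?_, ?_,
      Or.inr ⟨rfl, ?_⟩, ?_, fun s hs => ?_⟩
    · rw [config_rank f' _ 0, hr', ← h2]
      congr 1
    · simp only
      linarith
    · simp only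
      linarith
    · refine lt_of_lt_of_le ?_ (im_sub_le_dist _ _)
      simp only
      linarith
    · rcases lt_or_ge s (1 + 11 * S.rank f) with h | h
      · exact hg s h
      rcases Nat.lt_succ_iff_lt_or_eq.1 (show s < 1 + 11 * S.rank f + 10 + 1 by omega) with h' | h'
      · exact hg1 s h h'
      · exact h' ▸ g2

theorem exists_end : ∃ T ≤ 11 * n, ∃ L aim,
    S.exec T = S.config (min S.P.points.card (n - 1)) S.l L 0
      (S.memory .done (min S.P.points.card (n - 1)) aim) .idle ∧
    S.Clear (min S.P.points.card (n - 1)) S.l L ∧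
    (S.P.points.card = n → L = S.slot (n - 1)) ∧ ∀ s < T, S.Good s := by
  have hk := S.card_pos
  have hkn := S.card_le
  obtain ⟨m, hm⟩ : ∃ m, m = min S.P.points.card (n - 1) := ⟨_, rfl⟩
  rw [← hm]
  rcases m with _ | i
  -- The pattern is nonempty, so nothing to fetch means that the leader is alone.
  · have hn : n = 1 := by omega
    have hone := S.exec_one
    have hclear (z) : S.Clear 0 S.l z := fun j hj => by
      have := S.rank_lt hj
      omega
    rw [if_pos hn, show Stage.fillUp = if S.P.points.card = n then Stage.fillUp else .done by
      rw [if_pos (by omega)]] at hone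
    obtain ⟨T, hT, L, h, hL, hfill, hg⟩ := finish (Nat.zero_le _) (hclear _)
      (fun _ => ⟨by omega, fun z _ => hclear z⟩) hone
    refine ⟨T, by omega, L, _, h, hL, hfill, fun s hs => ?_⟩
    rcases Nat.eq_zero_or_pos s with rfl | h
    · exact S.good_zero
    · exact hg s h hs
  · obtain ⟨f, L, hf, rfl, h, hL, hL', hLr, hg⟩ := S.exists_fetch i (by omega)
    have hki : S.rank f < S.P.points.card := by omega
    have hre := (S.slot_bounds hki).1
    have hcor : S.corridor = S.corner.re - 90 := rfl
    obtain ⟨h1, hg1⟩ := fetch hf hki h hL hL' hLr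
    rw [config_succ hf _ 0] at h1
    obtain ⟨g2, h2⟩ := retreat hki (by omega) (by omega) h1
    have hclear : ∀ z ∈ segment ℝ ⟨S.corridor, (S.slot (S.rank f)).im - 2⟩
        ⟨S.corridor, (S.slot (n - 1)).im⟩, S.Clear (S.rank f + 1) S.l z := by
      intro z hz
      have a1 := le_re_of_mem_segment (c := S.corridor) (by simp) (by simp) hz
      have a2 := re_le_of_mem_segment (c := S.corridor) (by simp) (by simp) hz
      exact S.clear_of (S.slots_clear_of_re (by omega) (by linarith)) fun j _ _ _ =>
        S.starts_clear_of_re (by linarith) j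
    obtain ⟨T, hT, L', h3, hL'', hfill, hg3⟩ := finish (by omega)
      (hclear _ (left_mem_segment _ _ _)) (fun hkn' => ⟨by omega, hclear⟩) h2
    refine ⟨T, by omega, L', _, h3, hL'', hfill, fun s hs => ?_⟩
    rcases lt_or_ge s (1 + 11 * S.rank f) with h | h
    · exact hg s h
    rcases lt_or_ge s (1 + 11 * S.rank f + 10) with h' | h'
    · exact hg1 s h h'
    rcases h'.eq_or_lt with rfl | h'
    · exact g2
    · exact hg3 s h' hs

/-! ### The final configuration and the correctness in the turned frame -/

theorem outcome {L : ℂ} {m : LeaderMemory} (hL : S.P.points.card = n → L = S.slot (n - 1)) :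
    Outcome S.P id (S.P.shift S.corner) S.start
      (S.config (min S.P.points.card (n - 1)) S.l L 0 m .idle).pos S.l where
  emptyQuadrant j hj := by
    rintro ⟨h1, h2⟩
    have hn : n ≠ 1 := by
      have := S.rank_lt hj
      omega
    obtain ⟨h3, h4⟩ := S.vector_spec hn
    have h5 : dist (S.start j) S.c ^ 2 < dist (S.start S.l) S.c ^ 2 := by
      gcongr
      exact S.elected.circle j hj
    rw [dist_sq_eq, dist_sq_eq] at h5
    simp only [id, sub_re, sub_im] at h1 h2 h3 h4
    -- The leader is to the top left of `S.c`, so a robot in its top left quadrant would be at least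
    -- as far from `S.c` as the leader.
    nlinarith
  outside p hp j := by
    have h1 := S.shifted_re hp
    have h2 := S.shifted_im hp
    have h3 := S.corner_re_le j
    have h4 := S.le_corner_im j
    simp only [id]
    constructor <;> linarith
  formed p hp := by
    obtain ⟨i, hi, hip⟩ : ∃ i, ∃ hi : i < (ordered S.P.points).length,
      (ordered S.P.points)[i] = p := List.getElem_of_mem ((Finset.mem_sort (r := LeftTop)).2 hp)
    have hslot := S.slot_eq hi
    rw [hip] at hslot
    rw [length_ordered_points] at hi
    have hkn := S.card_le
    by_cases hin : i < n - 1
    · obtain ⟨f, hf, rfl⟩ := S.exists_rank hin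
      refine ⟨f, ?_⟩
      simp only [config, id]
      rw [S.place_other _ hf hf, ← hslot, rest, if_pos (by omega)]
    -- A slot of index at least `n - 1` exists only if the pattern has `n` points; it is then the
    -- leader's.
    · refine ⟨S.l, ?_⟩
      simp only [config, id]
      rw [S.place_leader, ← hslot, hL (by omega)]
      congr 1
      omega
  placed j hj i hij := by
    obtain rfl := S.rank_of_getElem (j := j) (i := i) hij
    have hr := S.rank_lt hj
    refine ⟨fun p hp => ?_, fun hk => ?_⟩
    · obtain ⟨hi, rfl⟩ := List.getElem?_eq_some_iff.1 hp
      have hslot := S.slot_eq hi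
      rw [length_ordered_points] at hi
      simp only [config, id]
      rw [S.place_other _ hj hj, ← hslot, rest, if_pos (by omega)]
    · simp only [config]
      rw [S.place_other _ hj hj, rest, if_neg (by omega)]
  leaderPlaced hk p hp := by
    obtain ⟨hi, rfl⟩ := List.getElem?_eq_some_iff.1 hp
    simp only [config, id]
    rw [S.place_leader, hL hk, S.slot_eq hi]

theorem isDone_config {i : ℕ} {L aim : ℂ} (j : Fin n) :
    ((S.config i S.l L 0 (S.memory .done i aim) .idle).mem j).IsDone := by
  by_cases hj : j = S.l <;> simp [config, hj, Memory.IsDone, memory]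

theorem correct :
    (∃ T ≤ 11 * n, (∀ i, ((S.exec T).mem i).IsDone) ∧ (∀ t ≥ T, S.exec t = S.exec T) ∧
      Outcome S.P id (S.P.shift S.corner) S.start (S.exec T).pos S.l) ∧ ∀ t, S.Good t := by
  obtain ⟨T, hT, L, aim, h, hL, hfill, hg⟩ := S.exists_end
  have hm : min S.P.points.card (n - 1) ≤ S.P.points.card := min_le_left _ _
  refine ⟨⟨T, hT, ?_, ?_, ?_⟩, fun t => ?_⟩
  · rw [h]
    exact S.isDone_config
  · rw [h]
    exact exec_done hm hL h
  · rw [h]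
    exact S.outcome hfill
  · rcases lt_or_ge t T with ht | ht
    · exact hg t ht
    · exact good_done hm hL h t ht

end Scene

/-! ### Transfer to the global coordinate system -/

theorem LeaderElected.map {n : ℕ} {pos : Fin n → ℂ} {l : Fin n} {c : ℂ} (A : ℂ ≃ᵃⁱ[ℝ] ℂ)
    (h : LeaderElected pos l c) : LeaderElected (fun i => A (pos i)) l (A c) where
  apart i j hij := by simpa only [A.dist_map] using h.apart i j hij
  visible i j hij := (h.visible i j hij).image A
  circle j hj := by simpa only [A.dist_map] using h.circle j hj

/-- The quarter turn, as an element of the unit circle. -/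
def circleI : Circle := ⟨I, by simp [Submonoid.unitSphere]⟩

/-- The isometry of the plane that applies `h` and then turns by `m` quarter turns. -/
def turned (h : ℂ ≃ᵃⁱ[ℝ] ℂ) (m : ℕ) : ℂ ≃ᵃⁱ[ℝ] ℂ :=
  h.trans (rotation (circleI ^ m)).toAffineIsometryEquiv

theorem turned_apply (h : ℂ ≃ᵃⁱ[ℝ] ℂ) (m : ℕ) (z : ℂ) : turned h m z = I ^ m * h z := by
  simp only [turned, AffineIsometryEquiv.coe_trans, Function.comp_apply,
    LinearIsometryEquiv.coe_toAffineIsometryEquiv, rotation_apply, Circle.coe_pow]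
  rfl

theorem collisionFree_map_iff {n : ℕ} {pos pos' : Fin n → ℂ} (A : ℂ ≃ᵃⁱ[ℝ] ℂ) :
    CollisionFree (fun i => A (pos i)) (fun i => A (pos' i)) ↔ CollisionFree pos pos' := by
  have h1 (a b : ℂ) : segment ℝ (A a) (A b) = A '' segment ℝ a b :=
    (image_segment ℝ A.toAffineEquiv.toAffineMap a b).symm
  simp only [CollisionFree, h1, Set.forall_mem_image, A.dist_map]

theorem sameRay_map_iff (A : ℂ ≃ᵃⁱ[ℝ] ℂ) (x y z w : ℂ) :
    SameRay ℝ (A x - A y) (A z - A w) ↔ SameRay ℝ (x - y) (z - w) := by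
  have h (a b : ℂ) : A a - A b = A.linearIsometryEquiv (a - b) := (A.map_vsub a b).symm
  rw [h, h]
  exact SameRay.sameRay_map_iff (e := A.linearIsometryEquiv.toLinearEquiv)

theorem Config.map_injective {n : ℕ} (A : ℂ ≃ᵃⁱ[ℝ] ℂ) :
    Function.Injective (Config.map (n := n) A) := by
  rintro ⟨p, m⟩ ⟨p', m'⟩ h
  simp only [Config.map, Config.mk.injEq] at h ⊢
  exact ⟨funext fun i => A.injective (congrFun h.1 i), h.2⟩

theorem Outcome.of_map {n : ℕ} {P : Pattern} {v : ℂ} {start final : Fin n → ℂ} {l : Fin n}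
    (A : ℂ ≃ᵃⁱ[ℝ] ℂ)
    (h : Outcome P id v (fun i => A (start i)) (fun i => A (final i)) l) :
    Outcome P A v start final l where
  emptyQuadrant := h.emptyQuadrant
  outside := h.outside
  formed := h.formed
  placed j hj i hi :=
    ⟨(h.placed j hj i hi).1, fun hk => A.injective ((h.placed j hj i hi).2 hk)⟩
  leaderPlaced := h.leaderPlaced

/-- The phase as seen in the turned coordinate system of the leader. -/
def sceneOf {n : ℕ} (P : Pattern) (frame : Fin n → ℂ ≃ᵃⁱ[ℝ] ℂ) (start : Fin n → ℂ) (l : Fin n)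
    (c : ℂ) (hk : P.points.card ≤ n) (h : LeaderElected start l c) : Scene n :=
  let turn := quarterTurns (frame l (start l) - frame l c)
  let A := turned (frame l) turn
  { P := P
    frame := fun i => A.symm.trans (frame i)
    start := fun i => A (start i)
    l := l
    c := A c
    turn := turn
    card_le := hk
    elected := h.map A
    frame_leader := fun z => by
      have := turned_apply (frame l) turn (A.symm z)
      rw [A.apply_symm_apply] at this
      exact this.symm
    turn_eq := by simp [turn] }

end FatRobots

end

theorem mainTheorem4 :
    ∃ C M : ℕ, ∀ (n : ℕ) (P : FatRobots.Pattern) (frame : Fin n → ℂ ≃ᵃⁱ[ℝ] ℂ)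
      (start : Fin n → ℂ) (l : Fin n) (c : ℂ),
      P.points.card ≤ n →
      FatRobots.LeaderElected start l c →
      -- the phase ends after at most `C * n` rounds, with the pattern formed
      (∃ T ≤ C * n,
        (∀ i, ((FatRobots.execution P frame start l c T).mem i).IsDone) ∧
        (∀ t ≥ T, FatRobots.execution P frame start l c t =
          FatRobots.execution P frame start l c T) ∧
        ∃ (m : Fin 4) (v : ℂ),
          FatRobots.Outcome P (fun z => Complex.I ^ (m : ℕ) * frame l z) v start
            (FatRobots.execution P frame start l c T).pos l) ∧
      -- there are no collisions
      (∀ t, FatRobots.CollisionFree (FatRobots.execution P frame start l c t).pos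
        (FatRobots.execution P frame start l c (t + 1)).pos) ∧
      -- every robot uses a bounded number of memory units
      (∀ t i, ((FatRobots.execution P frame start l c t).mem i).units n ≤ M) ∧
      -- one robot at a time moves
      (∀ t i j,
        (FatRobots.execution P frame start l c (t + 1)).pos i ≠
          (FatRobots.execution P frame start l c t).pos i →
        (FatRobots.execution P frame start l c (t + 1)).pos j ≠
          (FatRobots.execution P frame start l c t).pos j → i = j) ∧
      -- a robot other than the leader moves in round `t` only if the leader touched it two rounds
      -- before, showing the direction, and stood at the destination one round before
      (∀ t j, j ≠ l →
        (FatRobots.execution P frame start l c (t + 1)).pos j ≠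
          (FatRobots.execution P frame start l c t).pos j →
        ∃ s, t = s + 2 ∧
          (FatRobots.execution P frame start l c t).pos j =
            (FatRobots.execution P frame start l c s).pos j ∧
          dist ((FatRobots.execution P frame start l c s).pos l)
            ((FatRobots.execution P frame start l c s).pos j) = 1 ∧
          (FatRobots.execution P frame start l c (s + 1)).pos l =
            (FatRobots.execution P frame start l c (t + 1)).pos j ∧
          SameRay ℝ
            ((FatRobots.execution P frame start l c s).pos l -
              (FatRobots.execution P frame start l c s).pos j)
            ((FatRobots.execution P frame start l c (t + 1)).pos j -
              (FatRobots.execution P frame start l c s).pos j)) := by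
  -- Each of the at most `n - 1` fetched followers costs 11 rounds, and the spare 11 cover the
  -- departure and the last two moves. The leader uses at most 2 + 1 + 1 + 3 units.
  refine ⟨11, 7, fun n P frame start l c hk h => ?_⟩
  set turn := FatRobots.quarterTurns (frame l (start l) - frame l c)
  set A := FatRobots.turned (frame l) turn
  set E := FatRobots.execution P frame start l c
  obtain ⟨⟨T, hT, hdone, hstable, hout⟩, hgood⟩ :=
    (FatRobots.sceneOf P frame start l c hk h).correct
  have hmap (t : ℕ) : (FatRobots.sceneOf P frame start l c hk h).exec t = (E t).map A :=
    FatRobots.execution_map P A frame start l c t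
  simp only [hmap] at hdone hstable hout
  have hmove (t : ℕ) (j) (hj : (E (t + 1)).pos j ≠ (E t).pos j) :
      ((E (t + 1)).map A).pos j ≠ ((E t).map A).pos j := fun e => hj (A.injective e)
  refine ⟨⟨T, hT, hdone, fun t ht => FatRobots.Config.map_injective A (hstable t ht), turn,
    P.shift (FatRobots.sceneOf P frame start l c hk h).corner, ?_⟩,
    fun t => ?_, fun t => ?_, fun t i j hi hj => ?_, fun t j hjl hj => ?_⟩
  · rw [show (fun z => Complex.I ^ (turn : ℕ) * frame l z) = A from
      funext fun z => (FatRobots.turned_apply _ _ z).symm]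
    exact FatRobots.Outcome.of_map A hout
  · have := (hgood t).free
    rw [hmap, hmap] at this
    exact (FatRobots.collisionFree_map_iff A).1 this
  · have := (hgood t).units
    rw [hmap] at this
    exact this
  · have := (hgood t).single i j
    rw [hmap, hmap] at this
    exact this (hmove t i hi) (hmove t j hj)
  · have := (hgood t).shown j hjl
    simp only [hmap] at this
    obtain ⟨s, hs, h1, h2, h3, h4⟩ := this (hmove t j hj)
    exact ⟨s, hs, A.injective h1, (A.dist_map _ _).symm.trans h2, A.injective h3,
      (FatRobots.sameRay_map_iff A _ _ _ _).1 h4⟩
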